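/- **Model.** Let $k\ge 1$ be an integer and $\gamma\in[0,1)$. In the state $(x_n,t_n)\in\mathbb R_+\times\mathbb Z_+$ one chooses $r_n\in\{0,1\}$ and $u_n\in\mathbb R$; the pseudo-state is $(\xi_n,\tau_n)=(x_n,t_n)$ if $r_n=0$ and $(\xi_n,\tau_n)=(\zeta,0)$ if $r_n=1$; then a demand $w_n$ is realized, and $x_{n+1}=h(\xi_n,\tau_n,u_n,w_n)$, $t_{n+1}=\tau_n+1$. The stage cost $g$ and the reset cost $s$ are nonnegative and measurable. The reset-control problem is to minimize $$\mathbb E\Big[\sum_{n\ge0}\gamma^n\big(g(\xi_n,\tau_n,u_n,w_n)+s(x_n,t_n,w_n)\,r_n\big)\Big]$$ over all non-anticipating controls that satisfy, almost surely, $t_n\le k$ and $u_n\in\mathcal U_n$ for all $n$. (Non-anticipating: $(r_n,u_n)$ is $\mathcal F_n$-measurable for a given filtration such that $w_n$ is $\mathcal F_{n+1}$-measurable and independent of $\mathcal F_n$.) Let $J(x,t)$ be the minimal (infimal) cost from $(x_0,t_0)=(x,t)$, let $J_0=J(0,0)$, and let $\mathbb E$ in the formulas below be the expectation over one demand $w$.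 **Assumptions.** * **A1.** $h(\xi,\tau,u,w)=(\xi+u-w)^+$. * **A2.** There are constants $c,K\ge0$ and, for $t=0,\dots,k-1$, constants $\kappa_t\ge0$, $m_t>0$ and a function $H(\cdot,t)$, twice differentiable on $[0,c_{\max}]$ with $|\partial_zH(z,t)|\le\kappa_t$ and $\partial_{zz}H(z,t)\ge m_t$, such that for $\xi\in[0,c_{\max}]$, $u\in[0,c_{\max}-\xi]$ the cost $g(\xi,t,u,w)$ is integrable and $\mathbb E\,g(\xi,t,u,w)=cu+K\mathbf 1_{\{u>0\}}+H(\xi+u,t)$. * **A3.** $\zeta=0$. For $t=0,\dots,k$, $R(x,t)=\mathbb E\,s(x,t,w)$ is finite, concave and nondecreasing in $x\in[0,c_{\max}]$, with a Lipschitz continuous derivative satisfying $|\partial_xR(x,t)|\le\eta_t$. * **A4.** $\mathcal U_n=\{u:0\le u\le c_{\max}-\xi_n\}$, where $c_{\max}\ge0$. * **A5.** The $w_n$ are i.i.d. with a density $f$ such that $f=0$ on $(-\infty,0)$, and on $[0,\infty)$ $f$ is Lipschitz with constant $L\ge0$ and bounded by $P$. **Theorem.** Assume A1–A5 and $0\le\gamma\le\min_{0\le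 t\le k-1}\gamma_t$, where $$\gamma_{k-1}=\frac{m_{k-1}}{(Lc_{\max}+P)\,\eta_k},\qquad \gamma_t=\frac{m_t}{(Lc_{\max}+P)(\eta_{t+1}+c+\kappa_{t+1})+m_{t+1}}\quad(0\le t\le k-2)$$ (with $\gamma_{k-1}=+\infty$ if $\eta_k=0$). Then $J$ is finite on $[0,c_{\max}]\times\{0,\dots,k\}$, and there are $\varphi\in[0,c_{\max}]$ and, for $t=0,\dots,k-1$, numbers $S_t\in[0,c_{\max}]$ and $0\le\sigma_t\le s_t\le\Sigma_t\le+\infty$ such that the following hold. 1. The policy which, in a state $(x,t)$ with $t<k$, takes $r=1,u=\varphi$ if $x\in[0,\sigma_t)$; $r=0,u=S_t-x$ if $x\in[\sigma_t,s_t)$; $r=0,u=0$ if $x\in[s_t,\Sigma_t)$; and $r=1,u=\varphi$ if $x\ge\Sigma_t$; and which takes $r=1,u=\varphi$ if $t=k$, is admissible and optimal from every initial state $(x,t)$ with $x\in[0,c_{\max}]$, $0\le t\le k$. 2. For $x\in[0,c_{\max}]$ one has $J(x,k)=J_0+R(x,k)$ and, for $t=0,\dots,k-1$, $$J(x,t)=\begin{cases}J_0+R(x,t),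 & x\in[0,\sigma_t),\\ c(S_t-x)+K+H(S_t,t)+\gamma\,\mathbb E\,J((S_t-w)^+,t+1), & x\in[\sigma_t,s_t),\\ H(x,t)+\gamma\,\mathbb E\,J((x-w)^+,t+1), & x\in[s_t,\Sigma_t),\\ J_0+R(x,t), & x\ge\Sigma_t,\end{cases}$$ where the expectations of $J$ are finite. 3. For $t=0,\dots,k-1$, each of these expressions, as a function of $x\in[0,c_{\max}]$, is differentiable with derivative bounded in absolute value by $M_t=\eta_t+c+\kappa_t+m_t/(Lc_{\max}+P)$. The derivatives of the first, second and fourth are Lipschitz continuous, and so is that of the third if $\partial_zH(\cdot,t)$ is Lipschitz continuous (for instance if $H(\cdot,t)$ is $C^2$). -/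

import Mathlib

open MeasureTheory ProbabilityTheory
open scoped NNReal ENNReal

noncomputable section

namespace ResetControl

/-- Data of a scalar stochastic control problem with resets: reset state `ζ`, dynamics
`h ξ τ u w`, stage cost `g ξ τ u w ≥ 0`, reset cost `s x t w ≥ 0`, control constraint
`u ∈ U ξ τ w`, discount factor `γ`, and maximal time `k` between two resets. -/
structure Problem where
  ζ : ℝ
  h : ℝ → ℕ → ℝ → ℝ → ℝ
  g : ℝ → ℕ → ℝ → ℝ → ℝ≥0
  s : ℝ → ℕ → ℝ → ℝ≥0
  U : ℝ → ℕ → ℝ → Set ℝ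
  γ : ℝ
  k : ℕ

namespace Problem

variable (M : Problem)

/-- Pseudo-state `(ξ, τ)` after the reset decision `r` in the state `(x, t)`. -/
def pseudo (y : ℝ × ℕ) (r : Bool) : ℝ × ℕ := if r then (M.ζ, 0) else y

/-- Next state `(h ξ τ u w, τ + 1)`. -/
def next (y : ℝ × ℕ) (r : Bool) (u w : ℝ) : ℝ × ℕ :=
  (M.h (M.pseudo y r).1 (M.pseudo y r).2 u w, (M.pseudo y r).2 + 1)

/-- Cost of one period, `g ξ τ u w + s x t w · r`. -/
def periodCost (y : ℝ × ℕ) (r : Bool) (u w : ℝ) : ℝ≥0 :=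
  M.g (M.pseudo y r).1 (M.pseudo y r).2 u w + if r then M.s y.1 y.2 w else 0

/-- State `(x_n, t_n)` reached from `y₀` along given disturbances and controls. -/
def state (y₀ : ℝ × ℕ) (w : ℕ → ℝ) (r : ℕ → Bool) (u : ℕ → ℝ) : ℕ → ℝ × ℕ
  | 0 => y₀
  | n + 1 => M.next (state y₀ w r u n) (r n) (u n) (w n)

/-- Discounted cost `∑ γⁿ (g ξ_n τ_n u_n w_n + s x_n t_n w_n · r_n)` of a sample path. -/
def pathCost (y₀ : ℝ × ℕ) (w : ℕ → ℝ) (r : ℕ → Bool) (u : ℕ → ℝ) : ℝ≥0∞ :=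
  ∑' n, ENNReal.ofReal M.γ ^ n * (M.periodCost (M.state y₀ w r u n) (r n) (u n) (w n) : ℝ≥0∞)

/-- State of the closed loop under a feedback policy `π x t = (r, u)`. -/
def loopState (π : ℝ → ℕ → Bool × ℝ) (y₀ : ℝ × ℕ) (w : ℕ → ℝ) : ℕ → ℝ × ℕ
  | 0 => y₀
  | n + 1 => M.next (loopState π y₀ w n)
      (π (loopState π y₀ w n).1 (loopState π y₀ w n).2).1
      (π (loopState π y₀ w n).1 (loopState π y₀ w n).2).2 (w n)

end Problem

/-- A pair of random control sequences: reset decisions `r n` and inputs `u n`. -/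
structure Control (Ω : Type*) where
  r : ℕ → Ω → Bool
  u : ℕ → Ω → ℝ

namespace Problem

variable (M : Problem) {Ω : Type*} {mΩ : MeasurableSpace Ω}

/-- Expected discounted cost of a control started in `y₀`. -/
def cost (Pr : Measure Ω) (w : ℕ → Ω → ℝ) (y₀ : ℝ × ℕ) (a : Control Ω) : ℝ≥0∞ :=
  ∫⁻ ω, M.pathCost y₀ (fun n => w n ω) (fun n => a.r n ω) (fun n => a.u n ω) ∂Pr

/-- Admissible controls: the decisions at time `n` use only the information `ℱ n`, and almost
surely `t_n ≤ k` and `u_n ∈ U ξ_n τ_n w_n` for all `n`. -/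
structure Admissible (Pr : Measure Ω) (ℱ : Filtration ℕ mΩ) (w : ℕ → Ω → ℝ)
    (y₀ : ℝ × ℕ) (a : Control Ω) : Prop where
  adapted_r : ∀ n, Measurable[ℱ n] (a.r n)
  adapted_u : ∀ n, Measurable[ℱ n] (a.u n)
  time_le : ∀ᵐ ω ∂Pr, ∀ n,
    (M.state y₀ (fun j => w j ω) (fun j => a.r j ω) (fun j => a.u j ω) n).2 ≤ M.k
  input_mem : ∀ᵐ ω ∂Pr, ∀ n, ∀ y,
    y = M.pseudo (M.state y₀ (fun j => w j ω) (fun j => a.r j ω) (fun j => a.u j ω) n) (a.r n ω) →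
      a.u n ω ∈ M.U y.1 y.2 (w n ω)

/-- Optimal cost-to-go, as an infimum in `[0, ∞]` over all admissible controls. -/
def value (Pr : Measure Ω) (ℱ : Filtration ℕ mΩ) (w : ℕ → Ω → ℝ) (x : ℝ) (t : ℕ) : ℝ≥0∞ :=
  ⨅ (a : Control Ω) (_ : M.Admissible Pr ℱ w (x, t) a), M.cost Pr w (x, t) a

/-- Optimal cost-to-go as a real number. -/
def J (Pr : Measure Ω) (ℱ : Filtration ℕ mΩ) (w : ℕ → Ω → ℝ) (x : ℝ) (t : ℕ) : ℝ :=
  (M.value Pr ℱ w x t).toReal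

/-- The random controls generated from `y₀` by a feedback policy. -/
def feedback (w : ℕ → Ω → ℝ) (π : ℝ → ℕ → Bool × ℝ) (y₀ : ℝ × ℕ) : Control Ω where
  r n ω := (π (M.loopState π y₀ (fun j => w j ω) n).1 (M.loopState π y₀ (fun j => w j ω) n).2).1
  u n ω := (π (M.loopState π y₀ (fun j => w j ω) n).1 (M.loopState π y₀ (fun j => w j ω) n).2).2

/-- A feedback policy is optimal on the inventory levels `[0, cmax]` if, from every initial state
`(x, t)` with `x ∈ [0, cmax]` and `t ≤ k`, its controls are admissible and attain the optimal
cost-to-go. -/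
def IsOptimalPolicy (Pr : Measure Ω) (ℱ : Filtration ℕ mΩ) (w : ℕ → Ω → ℝ) (cmax : ℝ)
    (π : ℝ → ℕ → Bool × ℝ) : Prop :=
  ∀ x ∈ Set.Icc 0 cmax, ∀ t ≤ M.k,
    M.Admissible Pr ℱ w (x, t) (M.feedback w π (x, t)) ∧
      M.cost Pr w (x, t) (M.feedback w π (x, t)) = M.value Pr ℱ w x t

end Problem

/-- Law on `ℝ` with density `f`. -/
def demandLaw (f : ℝ → ℝ) : Measure ℝ := volume.withDensity fun y => ENNReal.ofReal (f y)

/-- Expected reset cost `R(x, t) = E s(x, t, w)` for demand density `f`. -/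
def Problem.R (M : Problem) (f : ℝ → ℝ) (x : ℝ) (t : ℕ) : ℝ :=
  ∫ y, (M.s x t y : ℝ) ∂demandLaw f

/-- Expected optimal cost-to-go `E J((z - w)⁺, t)` for demand density `f`. -/
def Problem.EJ {Ω : Type*} {mΩ : MeasurableSpace Ω} (M : Problem) (Pr : Measure Ω)
    (ℱ : Filtration ℕ mΩ) (w : ℕ → Ω → ℝ) (f : ℝ → ℝ) (z : ℝ) (t : ℕ) : ℝ :=
  ∫ y, M.J Pr ℱ w (max (z - y) 0) t ∂demandLaw f

/-- The (one-sided at the ends) derivative of `φ` on `D` exists and is bounded by `B`. -/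
def BoundedDerivOn (φ : ℝ → ℝ) (D : Set ℝ) (B : ℝ) : Prop :=
  ∃ φ' : ℝ → ℝ, ∀ x ∈ D, HasDerivWithinAt φ (φ' x) D x ∧ |φ' x| ≤ B

/-- The derivative of `φ` on `D` exists and is Lipschitz continuous. -/
def LipschitzDerivOn (φ : ℝ → ℝ) (D : Set ℝ) : Prop :=
  ∃ φ' : ℝ → ℝ, (∀ x ∈ D, HasDerivWithinAt φ (φ' x) D x) ∧ ∃ C : ℝ≥0, LipschitzOnWith C φ' D

/-- Lost-sales dynamics. -/
def A1 (M : Problem) : Prop :=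
  ∀ ξ τ u w, M.h ξ τ u w = max (ξ + u - w) 0

/-- Structure of the expected stage cost: linear ordering cost, fixed ordering cost, and a
strongly convex twice differentiable part `H`. -/
structure A2 (M : Problem) (f : ℝ → ℝ) (cmax c K : ℝ) (H : ℝ → ℕ → ℝ) (κ m : ℕ → ℝ) : Prop where
  c_nonneg : 0 ≤ c
  K_nonneg : 0 ≤ K
  m_pos : ∀ t < M.k, 0 < m t
  integrable : ∀ t < M.k, ∀ ξ ∈ Set.Icc 0 cmax, ∀ u ∈ Set.Icc 0 (cmax - ξ),
    Integrable (fun y => (M.g ξ t u y : ℝ)) (demandLaw f)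
  expect_eq : ∀ t < M.k, ∀ ξ ∈ Set.Icc 0 cmax, ∀ u ∈ Set.Icc 0 (cmax - ξ),
    ∫ y, (M.g ξ t u y : ℝ) ∂demandLaw f = c * u + K * (if 0 < u then 1 else 0) + H (ξ + u) t
  deriv_H : ∀ t < M.k, ∃ H' H'' : ℝ → ℝ, ∀ z ∈ Set.Icc 0 cmax,
    HasDerivWithinAt (fun y => H y t) (H' z) (Set.Icc 0 cmax) z ∧
    HasDerivWithinAt H' (H'' z) (Set.Icc 0 cmax) z ∧ |H' z| ≤ κ t ∧ m t ≤ H'' z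

/-- The reset state is `0`; the expected reset cost is concave, nondecreasing, with a bounded
and Lipschitz continuous derivative. -/
structure A3 (M : Problem) (f : ℝ → ℝ) (cmax : ℝ) (η : ℕ → ℝ) : Prop where
  zeta_eq : M.ζ = 0
  integrable : ∀ t ≤ M.k, ∀ x ∈ Set.Icc 0 cmax,
    Integrable (fun y => (M.s x t y : ℝ)) (demandLaw f)
  concave : ∀ t ≤ M.k, ConcaveOn ℝ (Set.Icc 0 cmax) (fun x => M.R f x t)
  mono : ∀ t ≤ M.k, MonotoneOn (fun x => M.R f x t) (Set.Icc 0 cmax)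
  deriv_bdd : ∀ t ≤ M.k, BoundedDerivOn (fun x => M.R f x t) (Set.Icc 0 cmax) (η t)
  deriv_lip : ∀ t ≤ M.k, LipschitzDerivOn (fun x => M.R f x t) (Set.Icc 0 cmax)

/-- Capacity constraint. -/
def A4 (M : Problem) (cmax : ℝ) : Prop :=
  0 ≤ cmax ∧ ∀ ξ τ w, M.U ξ τ w = {u | 0 ≤ u ∧ u ≤ cmax - ξ}

/-- The demands are i.i.d. with a density `f` that vanishes on the negative half-line and is
`L`-Lipschitz and bounded by `B` on `[0, ∞)`. -/
structure A5 {Ω : Type*} {mΩ : MeasurableSpace Ω} (Pr : Measure Ω) (w : ℕ → Ω → ℝ)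
    (f : ℝ → ℝ) (L B : ℝ) : Prop where
  measurable : ∀ n, Measurable (w n)
  indep : iIndepFun w Pr
  law : ∀ n, Pr.map (w n) = demandLaw f
  f_nonneg : ∀ y, 0 ≤ f y
  f_neg : ∀ y < 0, f y = 0
  L_nonneg : 0 ≤ L
  f_lip : ∀ y, 0 ≤ y → ∀ z, 0 ≤ z → |f y - f z| ≤ L * |y - z|
  f_bdd : ∀ y, 0 ≤ y → |f y| ≤ B

/-- The information available before each decision: `ℱ n` contains the past demands
`w 0, …, w (n - 1)` and is independent of the current demand `w n`. -/
structure Information {Ω : Type*} {mΩ : MeasurableSpace Ω} (Pr : Measure Ω)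
    (ℱ : Filtration ℕ mΩ) (w : ℕ → Ω → ℝ) : Prop where
  past : ∀ n, Measurable[ℱ (n + 1)] (w n)
  indep : ∀ n, Indep (MeasurableSpace.comap (w n) inferInstance) (ℱ n) Pr

/-- The constants `γ_t`, with values in `[0, ∞]`; a positive number divided by `0` is `∞`. -/
def gammaBound (k : ℕ) (cmax c L B : ℝ) (κ m η : ℕ → ℝ) (t : ℕ) : ℝ≥0∞ :=
  if t + 1 = k then ENNReal.ofReal (m t) / ENNReal.ofReal ((L * cmax + B) * η k)
  else ENNReal.ofReal (m t) /
    ENNReal.ofReal ((L * cmax + B) * (η (t + 1) + c + κ (t + 1)) + m (t + 1))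

/-- The four-threshold policy, for `t < k`; at `t = k` the system is reset.
The value is the pair `(r, u)`. -/
def thresholdPolicy (k : ℕ) (σ s : ℕ → EReal) (S : ℕ → ℝ) (Sig : ℕ → EReal) (φ : ℝ) :
    ℝ → ℕ → Bool × ℝ := fun x t =>
  if t < k then
    if (x : EReal) < σ t then (true, φ)
    else if (x : EReal) < s t then (false, S t - x)
    else if (x : EReal) < Sig t then (false, 0)
    else (true, φ)
  else (true, φ)

end ResetControl

/-! The difficulty is circular: a reset costs `R` plus the unknown number J(0,0), which depends on
the whole problem. Replace that number by a parameter `lam`. For fixed `lam` the problem becomes a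
backward recursion over t = k, ..., 0, where each value function is the smaller of the reset cost
`lam + R` and the best ordering cost.

The value functions are in general not convex, being minima that involve a concave function, so
convexity cannot be propagated. Only a Lipschitz bound N_t (`lipBound`) is. Averaging over the
demand compensates: if V is N-Lipschitz, the expectation of V((z - w)⁺) has a derivative that is
Lipschitz with constant (L cmax + B) N (`expectDeriv_lipschitz`). The bound on γ says exactly that γ
times this constant, for N = N_{t+1}, is at most m_t, so the strong convexity of H makes the
continuation cost G convex (`convexOn_add_of_lipschitz_deriv`). With a fixed ordering cost, a convex
G gives an (s, S) rule. Comparing it with a concave nondecreasing reset cost leaves one interval on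
which not resetting is at least as good (`stepValue_thresholdForm`). The resulting minimum is
N_t-Lipschitz, which closes the induction (`exists_step`).

The solution depends on `lam` in a 1-Lipschitz way (`solution_le`). The optimal cost of starting at
(0,0) without a reset carries one more factor γ, so it is a contraction in `lam`, and its fixed
point is the consistent reset cost (`exists_fixed_solution`). A verification argument identifies the
solution with J: every admissible control costs at least as much (`stateValue_le_cost`), and the
threshold policy attains it (`cost_feedback_le`). -/

namespace ResetControl

/-! ### One period: convex ordering problem against a concave reset cost. -/

/-- Expected ordering and holding cost-to-go of an order `u` at level `x`. -/
def orderCost (c K : ℝ) (G : ℝ → ℝ) (x u : ℝ) : ℝ :=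
  c * u + K * (if 0 < u then 1 else 0) + G (x + u)

/-- `V` has four pieces, separated by `σ ≤ s ≤ Sig`: reset, order up to `S`, idle, reset. -/
structure ThresholdForm (cmax c K lam : ℝ) (R G V : ℝ → ℝ) (S : ℝ) (σ s Sig : EReal) :
    Prop where
  nonneg : 0 ≤ σ
  le_s : σ ≤ s
  le_Sig : s ≤ Sig
  S_mem : S ∈ Set.Icc 0 cmax
  low : ∀ x ∈ Set.Icc 0 cmax, (x : EReal) < σ → V x = lam + R x
  order : ∀ x ∈ Set.Icc 0 cmax, σ ≤ (x : EReal) → (x : EReal) < s →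
    x < S ∧ V x = c * (S - x) + K + G S
  idle : ∀ x ∈ Set.Icc 0 cmax, s ≤ (x : EReal) → (x : EReal) < Sig → V x = G x
  high : ∀ x ∈ Set.Icc 0 cmax, Sig ≤ (x : EReal) → V x = lam + R x

theorem continuousOn_of_abs_sub_le {φ : ℝ → ℝ} {D : Set ℝ} {N : ℝ}
    (h : ∀ x ∈ D, ∀ y ∈ D, |φ x - φ y| ≤ N * |x - y|) : ContinuousOn φ D := by
  have : LipschitzOnWith N.toNNReal φ D := by
    refine LipschitzOnWith.of_dist_le_mul fun x hx y hy => ?_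
    rw [Real.dist_eq, Real.dist_eq]
    refine (h x hx y hy).trans ?_
    gcongr
    exact Real.le_coe_toNNReal N
  exact this.continuousOn

/-- The fixed cost makes the cost discontinuous at u = 0, so compactness is applied to cz + G(z)
instead. The best positive order is then compared with ordering nothing. -/
theorem exists_optimal_order {cmax c K : ℝ} {G : ℝ → ℝ} (h0 : 0 ≤ cmax) (hK : 0 ≤ K)
    (hG : ContinuousOn G (Set.Icc 0 cmax)) :
    ∃ φ ∈ Set.Icc 0 cmax, ∀ u ∈ Set.Icc 0 cmax, orderCost c K G 0 φ ≤ orderCost c K G 0 u := by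
  obtain ⟨S, hS, hmin⟩ := isCompact_Icc.exists_isMinOn (Set.nonempty_Icc.2 h0)
    (f := fun z => c * z + G z) (by fun_prop)
  have hmin' : ∀ z ∈ Set.Icc 0 cmax, c * S + G S ≤ c * z + G z := fun z hz => hmin hz
  by_cases h : G 0 ≤ K + c * S + G S
  · refine ⟨0, ⟨le_rfl, h0⟩, fun u hu => ?_⟩
    have := hmin' u hu
    rcases hu.1.eq_or_lt with rfl | hu0
    · exact le_rfl
    · simp only [orderCost, hu0, if_true, lt_irrefl, if_false, zero_add]
      linarith
  · refine ⟨S, hS, fun u hu => ?_⟩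
    have := hmin' u hu
    rcases hu.1.eq_or_lt with rfl | hu0
    · simp only [orderCost, lt_irrefl, if_false, zero_add]
      split_ifs <;> linarith
    · simp only [orderCost, hu0, if_true, zero_add]
      split_ifs <;> linarith

section OneStep

variable {cmax c K lam η ℓ : ℝ} {R G : ℝ → ℝ}

/-- Minimum of a reset cost and the optimal ordering cost with order-up-to level `S`. -/
def stepValue (c K lam : ℝ) (R G : ℝ → ℝ) (S x : ℝ) : ℝ :=
  min (lam + R x) (min (G x) (K + G (max x S) + c * (max x S - x)))

theorem abs_min_sub_min_le {a b a' b' e : ℝ} (h : |a - a'| ≤ e) (h' : |b - b'| ≤ e) :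
    |min a b - min a' b'| ≤ e :=
  (abs_min_sub_min_le_max _ _ _ _).trans (max_le h h')

/-- A minimum keeps any Lipschitz constant common to its branches. Both `max x S` and `max x S - x`
are 1-Lipschitz in `x`, so the ordering branch contributes c + ℓ. -/
theorem stepValue_lipschitz {S : ℝ} (hS : S ∈ Set.Icc 0 cmax) (hc : 0 ≤ c)
    (hη : ∀ x ∈ Set.Icc 0 cmax, ∀ y ∈ Set.Icc 0 cmax, |R x - R y| ≤ η * |x - y|)
    (hℓ : ∀ x ∈ Set.Icc 0 cmax, ∀ y ∈ Set.Icc 0 cmax, |G x - G y| ≤ ℓ * |x - y|)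
    (hη0 : 0 ≤ η) (hℓ0 : 0 ≤ ℓ) {x y : ℝ} (hx : x ∈ Set.Icc 0 cmax) (hy : y ∈ Set.Icc 0 cmax) :
    |stepValue c K lam R G S x - stepValue c K lam R G S y| ≤ (η + c + ℓ) * |x - y| := by
  have hxy := abs_nonneg (x - y)
  have hmx : max x S ∈ Set.Icc 0 cmax := ⟨hx.1.trans (le_max_left _ _), max_le hx.2 hS.2⟩
  have hmy : max y S ∈ Set.Icc 0 cmax := ⟨hy.1.trans (le_max_left _ _), max_le hy.2 hS.2⟩
  have e1 := mul_nonneg hη0 hxy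
  have e2 := mul_nonneg hℓ0 hxy
  have e3 := mul_nonneg hc hxy
  refine abs_min_sub_min_le ?_ (abs_min_sub_min_le ?_ ?_)
  · have := hη x hx y hy
    rw [add_sub_add_left_eq_sub]
    linarith
  · have := hℓ x hx y hy
    linarith
  · have h1 : |max x S - max y S| ≤ |x - y| := by
      simpa using abs_max_sub_max_le_max x S y S
    have h2 := (hℓ _ hmx _ hmy).trans (mul_le_mul_of_nonneg_left h1 hℓ0)
    have h3 : |(max x S - x) - (max y S - y)| ≤ |x - y| := by
      rcases max_cases x S with ⟨h, h'⟩ | ⟨h, h'⟩ <;> rcases max_cases y S with ⟨k, k'⟩ | ⟨k, k'⟩ <;>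
        rw [h, k] <;> rcases abs_cases (x - y) with ⟨q, q'⟩ | ⟨q, q'⟩ <;> rw [q, abs_le] <;>
        constructor <;> linarith
    have h4 := mul_le_mul_of_nonneg_left h3 hc
    rw [← abs_of_nonneg hc, ← abs_mul, abs_of_nonneg hc] at h4
    have : K + G (max x S) + c * (max x S - x) - (K + G (max y S) + c * (max y S - y)) =
      (G (max x S) - G (max y S)) + c * ((max x S - x) - (max y S - y)) := by ring
    rw [this]
    refine (abs_add_le _ _).trans ?_
    linarith

/-- Below S the best target is the global minimizer S. Above S the convex function cz + G(z) is
nondecreasing, so an order does not pay even without the fixed cost. -/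
theorem stepValue_le_orderCost {S : ℝ} (hS : S ∈ Set.Icc 0 cmax) (hc : 0 ≤ c) (hK : 0 ≤ K)
    (hG : ConvexOn ℝ (Set.Icc 0 cmax) G) (hmin : ∀ z ∈ Set.Icc 0 cmax, c * S + G S ≤ c * z + G z)
    {x u : ℝ} (hx : x ∈ Set.Icc 0 cmax) (hu : u ∈ Set.Icc 0 (cmax - x)) :
    stepValue c K lam R G S x ≤ orderCost c K G x u := by
  have hm : x + u ∈ Set.Icc 0 cmax := ⟨add_nonneg hx.1 hu.1, by linarith [hu.2]⟩
  refine (min_le_right _ _).trans ?_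
  unfold orderCost
  rcases hu.1.eq_or_lt with rfl | hu0
  · simp
  · rw [if_pos hu0]
    rcases le_total x S with h | h
    · refine (min_le_right _ _).trans ?_
      rw [max_eq_right h]
      linarith [hmin _ hm]
    · refine (min_le_left _ _).trans ?_
      have hconv : ConvexOn ℝ (Set.Icc 0 cmax) (fun z => c * z + G z) :=
        ((convexOn_id (convex_Icc 0 cmax)).smul hc).add hG
      have h1 := hconv.le_max_of_mem_Icc hS hm (z := x) ⟨h, by linarith⟩
      rw [max_eq_right (hmin _ hm)] at h1
      linarith

/-- Let `B` be the cost of ordering up to S and `s₀` the first point where idling is no worse than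
ordering. The difference `D` between the best cost without reset and the reset cost is nonincreasing
left of `s₀`, because ordering has slope -c and R is nondecreasing. Right of `s₀` it is the convex
function G - R - lam. Hence {D ≤ 0} is an interval [a, b], which `s₀` may cut into an ordering and
an idling part. -/
theorem stepValue_thresholdForm {S : ℝ} (hS : S ∈ Set.Icc 0 cmax) (hc : 0 ≤ c)
    (hK : 0 ≤ K) (hR : ConcaveOn ℝ (Set.Icc 0 cmax) R) (hRm : MonotoneOn R (Set.Icc 0 cmax))
    (hRc : ContinuousOn R (Set.Icc 0 cmax)) (hG : ConvexOn ℝ (Set.Icc 0 cmax) G)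
    (hGc : ContinuousOn G (Set.Icc 0 cmax))
    (hmin : ∀ z ∈ Set.Icc 0 cmax, c * S + G S ≤ c * z + G z) :
    ∃ σ s Sig : EReal,
      ThresholdForm cmax c K lam R G (stepValue c K lam R G S) S σ s Sig := by
  have hconv : ConvexOn ℝ (Set.Icc 0 cmax) (fun z => c * z + G z) :=
    ((convexOn_id (convex_Icc 0 cmax)).smul hc).add hG
  set B : ℝ → ℝ := fun x => K + G (max x S) + c * (max x S - x) with hB
  have hBc : ContinuousOn B (Set.Icc 0 cmax) := by
    have : ContinuousOn (fun x => G (max x S)) (Set.Icc 0 cmax) :=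
      hGc.comp (by fun_prop) fun x hx => ⟨hx.1.trans (le_max_left _ _), max_le hx.2 hS.2⟩
    exact (continuousOn_const.add this).add (by fun_prop)
  have hBS : ∀ x ≤ S, B x = K + G S + c * (S - x) := fun x hx => by simp [hB, max_eq_right hx]
  set E : Set ℝ := {x ∈ Set.Icc 0 cmax | G x ≤ B x} with hE
  have hEc : IsCompact E :=
    isCompact_Icc.of_isClosed_subset (isClosed_Icc.isClosed_le hGc hBc) fun x hx => hx.1
  have hSE : S ∈ E := ⟨hS, by rw [hBS S le_rfl]; linarith⟩
  set s₀ := sInf E with hs₀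
  have hs₀E : s₀ ∈ E := hEc.sInf_mem ⟨S, hSE⟩
  have hs₀S : s₀ ≤ S := csInf_le hEc.bddBelow hSE
  have hlt : ∀ x ∈ Set.Icc 0 cmax, x < s₀ → B x < G x := fun x hx hxs => by
    by_contra hcon
    exact absurd (csInf_le hEc.bddBelow (a := x) ⟨hx, not_lt.1 hcon⟩) (not_le.2 hxs)
  have hge : ∀ x ∈ Set.Icc 0 cmax, s₀ ≤ x → G x ≤ B x := fun x hx hxs => by
    rcases le_total x S with h | h
    · have h1 := hconv.le_max_of_mem_Icc hs₀E.1 hS (z := x) ⟨hxs, h⟩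
      rw [max_eq_left (hmin _ hs₀E.1)] at h1
      have h2 := hs₀E.2
      rw [hBS _ hs₀S] at h2
      rw [hBS _ h]
      linarith
    · simp only [hB, max_eq_left h]
      linarith
  set D : ℝ → ℝ := fun x => min (G x) (B x) - (lam + R x) with hD
  have hDc : ContinuousOn D (Set.Icc 0 cmax) :=
    (ContinuousOn.inf hGc hBc).sub (continuousOn_const.add hRc)
  have hDanti : ∀ x ∈ Set.Icc 0 cmax, x ≤ s₀ → ∀ y ≤ x, 0 ≤ y → D x ≤ D y := by
    intro x hx hxs y hyx hy
    rcases hyx.eq_or_lt with rfl | hyx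
    · exact le_rfl
    have hy' : y ∈ Set.Icc 0 cmax := ⟨hy, hyx.le.trans hx.2⟩
    have h1 := hRm hy' hx hyx.le
    have h2 : min (G y) (B y) = B y := min_eq_right (hlt y hy' (hyx.trans_le hxs)).le
    have h3 : min (G x) (B x) ≤ B x := min_le_right _ _
    simp only [hD, h2]
    rw [hBS x (hxs.trans hs₀S)] at h3 ⊢
    rw [hBS y (hyx.le.trans (hxs.trans hs₀S))]
    have := mul_le_mul_of_nonneg_left hyx.le hc
    linarith
  have hDconv : ∀ x ∈ Set.Icc 0 cmax, s₀ ≤ x → ∀ z ∈ Set.Icc 0 cmax, ∀ y ∈ Set.Icc x z,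
      D x ≤ 0 → D z ≤ 0 → D y ≤ 0 := by
    intro x hx hxs z hz y hy hDx hDz
    have hy' : y ∈ Set.Icc 0 cmax := ⟨hx.1.trans hy.1, hy.2.trans hz.2⟩
    have key : ∀ q ∈ Set.Icc 0 cmax, s₀ ≤ q → D q = G q - R q - lam := fun q hq hqs => by
      simp only [hD, min_eq_left (hge q hq hqs)]; ring
    have h1 := (hG.sub hR).le_max_of_mem_Icc hx hz hy
    rw [key x hx hxs] at hDx
    rw [key z hz (hxs.trans (hy.1.trans hy.2))] at hDz
    rw [key y hy' (hxs.trans hy.1)]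
    have : max ((G - R) x) ((G - R) z) ≤ lam := max_le (by simpa using hDx) (by simpa using hDz)
    simp only [Pi.sub_apply] at h1 this
    linarith
  -- When the interval straddles `s₀`, monotonicity carries D ≤ 0 from x to `s₀`, and convexity
  -- takes over from there.
  have hDord : ∀ x ∈ Set.Icc 0 cmax, ∀ z ∈ Set.Icc 0 cmax, ∀ y ∈ Set.Icc x z,
      D x ≤ 0 → D z ≤ 0 → D y ≤ 0 := by
    intro x hx z hz y hy hDx hDz
    have hy' : y ∈ Set.Icc 0 cmax := ⟨hx.1.trans hy.1, hy.2.trans hz.2⟩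
    rcases le_total y s₀ with h | h
    · exact (hDanti y hy' h x hy.1 hx.1).trans hDx
    · rcases le_total s₀ x with h' | h'
      · exact hDconv x hx h' z hz y hy hDx hDz
      · exact hDconv s₀ hs₀E.1 le_rfl z hz y ⟨h, hy.2⟩
          ((hDanti s₀ hs₀E.1 le_rfl x h' hx.1).trans hDx) hDz
  have hVreset : ∀ x, 0 ≤ D x → stepValue c K lam R G S x = lam + R x := fun x hx =>
    min_eq_left (by simpa [hD] using hx)
  have hVorder : ∀ x, D x ≤ 0 → stepValue c K lam R G S x = min (G x) (B x) := fun x hx =>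
    min_eq_right (sub_nonpos.1 hx)
  set F : Set ℝ := {x ∈ Set.Icc 0 cmax | D x ≤ 0} with hF
  rcases F.eq_empty_or_nonempty with hFe | hFne
  -- Resetting is strictly better everywhere: with all thresholds 0, every level lies in the last
  -- piece.
  · refine ⟨0, 0, 0, le_rfl, le_rfl, le_rfl, hS, ?_, ?_, ?_, ?_⟩
    · exact fun x hx h => absurd (EReal.coe_nonneg.2 hx.1) (not_le.2 h)
    · exact fun x hx _ h => absurd (EReal.coe_nonneg.2 hx.1) (not_le.2 h)
    · exact fun x hx _ h => absurd (EReal.coe_nonneg.2 hx.1) (not_le.2 h)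
    · intro x hx _
      refine hVreset x ?_
      by_contra hcon
      have : x ∈ F := ⟨hx, (not_le.1 hcon).le⟩
      simp [hFe] at this
  have hFc : IsCompact F :=
    isCompact_Icc.of_isClosed_subset (isClosed_Icc.isClosed_le hDc continuousOn_const)
      fun x hx => hx.1
  set a := sInf F
  set b := sSup F
  have ha : a ∈ F := hFc.sInf_mem hFne
  have hb : b ∈ F := hFc.sSup_mem hFne
  have hab : a ≤ b := csInf_le hFc.bddBelow hb
  have hleft : ∀ x ∈ Set.Icc 0 cmax, x < a → 0 < D x := fun x hx h => by
    by_contra hcon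
    exact absurd (csInf_le hFc.bddBelow (a := x) ⟨hx, not_lt.1 hcon⟩) (not_le.2 h)
  have hright : ∀ x ∈ Set.Icc 0 cmax, b < x → 0 < D x := fun x hx h => by
    by_contra hcon
    exact absurd (le_csSup hFc.bddAbove (a := x) ⟨hx, not_lt.1 hcon⟩) (not_le.2 h)
  have hsb : max a s₀ ≤ b := by
    refine max_le hab ?_
    rcases le_total s₀ a with h | h
    · exact h.trans hab
    · exact le_csSup hFc.bddAbove ⟨hs₀E.1, (hDanti s₀ hs₀E.1 le_rfl a h ha.1.1).trans ha.2⟩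
  -- The level b itself belongs to the last piece, so both costs must agree there. Otherwise the
  -- intermediate value theorem would give a zero of D beyond b.
  have hDb : b < cmax → 0 ≤ D b := by
    intro hbc
    have hcm : cmax ∈ Set.Icc 0 cmax := ⟨hS.1.trans hS.2, le_rfl⟩
    have hsub : Set.Icc b cmax ⊆ Set.Icc 0 cmax := Set.Icc_subset_Icc_left hb.1.1
    obtain ⟨x, hx, hx0⟩ := intermediate_value_Icc hbc.le (hDc.mono hsub)
      (show (0 : ℝ) ∈ Set.Icc (D b) (D cmax) from ⟨hb.2, (hright cmax hcm hbc).le⟩)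
    have : x ≤ b := le_csSup hFc.bddAbove ⟨hsub hx, hx0.le⟩
    rw [le_antisymm hx.1 this, hx0]
  have hmid : ∀ x, a ≤ x → x ≤ b → D x ≤ 0 := fun x h1 h2 =>
    hDord a ha.1 b hb.1 x ⟨h1, h2⟩ ha.2 hb.2
  -- If b = cmax, the last threshold is ∞, since the half-open idling piece would otherwise miss
  -- cmax.
  refine ⟨a, (max a s₀ : ℝ), if b < cmax then (b : EReal) else ⊤, EReal.coe_nonneg.2 ha.1.1,
    EReal.coe_le_coe_iff.2 (le_max_left _ _), ?_, hS, ?_, ?_, ?_, ?_⟩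
  · split_ifs
    · exact EReal.coe_le_coe_iff.2 hsb
    · exact le_top
  · intro x hx h
    exact hVreset x (hleft x hx (EReal.coe_lt_coe_iff.1 h)).le
  · intro x hx h1 h2
    rw [EReal.coe_le_coe_iff] at h1
    rw [EReal.coe_lt_coe_iff] at h2
    have h3 : x < s₀ := (lt_max_iff.1 h2).resolve_left (not_lt.2 h1)
    refine ⟨h3.trans_le hs₀S, ?_⟩
    rw [hVorder x (hmid x h1 (h2.le.trans hsb)), min_eq_right (hlt x hx h3).le,
      hBS x (h3.le.trans hs₀S)]
    ring
  · intro x hx h1 h2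
    rw [EReal.coe_le_coe_iff] at h1
    have hxb : x ≤ b := by
      split_ifs at h2 with h
      · exact (EReal.coe_lt_coe_iff.1 h2).le
      · exact hx.2.trans (not_lt.1 h)
    rw [hVorder x (hmid x ((le_max_left _ _).trans h1) hxb),
      min_eq_left (hge x hx ((le_max_right _ _).trans h1))]
  · intro x hx h1
    split_ifs at h1 with h
    · rw [EReal.coe_le_coe_iff] at h1
      rcases h1.eq_or_lt with rfl | h1
      · exact hVreset _ (hDb h)
      · exact hVreset x (hright x hx h1).le
    · simp at h1

end OneStep

/-! ### Value functions extended to the whole line. -/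

/-- Projection of the real line onto `[0, cmax]`. -/
def clamp (cmax x : ℝ) : ℝ := max 0 (min x cmax)

theorem clamp_mem {cmax : ℝ} (h : 0 ≤ cmax) (x : ℝ) : clamp cmax x ∈ Set.Icc 0 cmax :=
  ⟨le_max_left _ _, max_le h (min_le_right _ _)⟩

theorem clamp_of_mem {cmax x : ℝ} (h : x ∈ Set.Icc 0 cmax) : clamp cmax x = x := by
  rw [clamp, min_eq_left h.2, max_eq_right h.1]

theorem abs_clamp_sub_le (cmax x y : ℝ) : |clamp cmax x - clamp cmax y| ≤ |x - y| := by
  have h1 := abs_max_sub_max_le_max 0 (min x cmax) 0 (min y cmax)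
  have h2 := abs_min_sub_min_le_max x cmax y cmax
  simp only [sub_self, abs_zero, abs_nonneg, max_eq_right, max_eq_left] at h1 h2
  exact h1.trans h2

/-- Value functions that occur in the backward recursion: `N`-Lipschitz and constant outside
`[0, cmax]`. -/
structure Tame (cmax N : ℝ) (V : ℝ → ℝ) : Prop where
  lip : ∀ x y, |V x - V y| ≤ N * |x - y|
  clamp_eq : ∀ x, V (clamp cmax x) = V x

theorem Tame.comp_clamp {cmax N : ℝ} {V : ℝ → ℝ} (h0 : 0 ≤ cmax) (hN : 0 ≤ N)
    (h : ∀ x ∈ Set.Icc 0 cmax, ∀ y ∈ Set.Icc 0 cmax, |V x - V y| ≤ N * |x - y|) :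
    Tame cmax N (fun x => V (clamp cmax x)) where
  lip x y := (h _ (clamp_mem h0 x) _ (clamp_mem h0 y)).trans
    (mul_le_mul_of_nonneg_left (abs_clamp_sub_le _ _ _) hN)
  clamp_eq x := by rw [clamp_of_mem (clamp_mem h0 x)]

/-- One step of the backward recursion, with a convex continuation cost `G` and a concave reset
cost `lam + R`. -/
theorem exists_thresholdForm {cmax c K lam η ℓ : ℝ} {R G : ℝ → ℝ} (h0 : 0 ≤ cmax) (hc : 0 ≤ c)
    (hK : 0 ≤ K) (hη0 : 0 ≤ η) (hℓ0 : 0 ≤ ℓ) (hR : ConcaveOn ℝ (Set.Icc 0 cmax) R)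
    (hRm : MonotoneOn R (Set.Icc 0 cmax))
    (hη : ∀ x ∈ Set.Icc 0 cmax, ∀ y ∈ Set.Icc 0 cmax, |R x - R y| ≤ η * |x - y|)
    (hG : ConvexOn ℝ (Set.Icc 0 cmax) G)
    (hℓ : ∀ x ∈ Set.Icc 0 cmax, ∀ y ∈ Set.Icc 0 cmax, |G x - G y| ≤ ℓ * |x - y|) :
    ∃ V : ℝ → ℝ, Tame cmax (η + c + ℓ) V ∧
      (∀ x ∈ Set.Icc 0 cmax, V x ≤ lam + R x) ∧
      (∀ x ∈ Set.Icc 0 cmax, ∀ u ∈ Set.Icc 0 (cmax - x), V x ≤ orderCost c K G x u) ∧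
      ∃ S σ s Sig, ThresholdForm cmax c K lam R G V S σ s Sig := by
  have hGc := continuousOn_of_abs_sub_le hℓ
  obtain ⟨S, hS, hmin⟩ := isCompact_Icc.exists_isMinOn (Set.nonempty_Icc.2 h0)
    (f := fun z => c * z + G z) (by fun_prop)
  have hmin' : ∀ z ∈ Set.Icc 0 cmax, c * S + G S ≤ c * z + G z := fun z hz => hmin hz
  obtain ⟨σ, s, Sig, hT⟩ := stepValue_thresholdForm (lam := lam) hS hc hK hR hRm
    (continuousOn_of_abs_sub_le hη) hG hGc hmin'
  refine ⟨fun x => stepValue c K lam R G S (clamp cmax x),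
    Tame.comp_clamp h0 (by positivity)
      fun x hx y hy => stepValue_lipschitz hS hc hη hℓ hη0 hℓ0 hx hy, ?_, ?_, S, σ, s, Sig,
    hT.nonneg, hT.le_s, hT.le_Sig, hT.S_mem, ?_, ?_, ?_, ?_⟩
  · intro x hx
    simp only [clamp_of_mem hx]
    exact min_le_left _ _
  · intro x hx u hu
    simp only [clamp_of_mem hx]
    exact stepValue_le_orderCost hS hc hK hG hmin' hx hu
  · intro x hx
    simp only [clamp_of_mem hx]
    exact hT.low x hx
  · intro x hx
    simp only [clamp_of_mem hx]
    exact hT.order x hx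
  · intro x hx
    simp only [clamp_of_mem hx]
    exact hT.idle x hx
  · intro x hx
    simp only [clamp_of_mem hx]
    exact hT.high x hx

/-! ### Smoothing by the demand density. -/

/-- A probability density on the half-line, `L`-Lipschitz and bounded by `B` there. -/
structure DemandDensity (f : ℝ → ℝ) (L B : ℝ) : Prop where
  prob : IsProbabilityMeasure (demandLaw f)
  nonneg : ∀ y, 0 ≤ f y
  neg : ∀ y < 0, f y = 0
  L_nonneg : 0 ≤ L
  lip : ∀ y, 0 ≤ y → ∀ z, 0 ≤ z → |f y - f z| ≤ L * |y - z|
  bdd : ∀ y, 0 ≤ y → |f y| ≤ B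

namespace DemandDensity

variable {f : ℝ → ℝ} {L B : ℝ}

/-- The density is continuous on the closed half-line and zero elsewhere, so measurability need not
be assumed. -/
theorem measurable (h : DemandDensity f L B) : Measurable f := by
  have hc : ContinuousOn f (Set.Ici 0) :=
    continuousOn_of_abs_sub_le fun x hx y hy => h.lip x hx y hy
  have : f = (Set.Ici (0 : ℝ)).piecewise f (fun _ => 0) := by
    ext y
    by_cases hy : 0 ≤ y
    · rw [Set.piecewise_eq_of_mem _ _ _ (Set.mem_Ici.2 hy)]
    · rw [Set.piecewise_eq_of_notMem _ _ _ (by simpa using hy), h.neg y (not_le.1 hy)]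
  rw [this]
  exact hc.measurable_piecewise continuousOn_const measurableSet_Ici

theorem integral_eq (h : DemandDensity f L B) (φ : ℝ → ℝ) :
    ∫ y, φ y ∂demandLaw f = ∫ y, f y * φ y := by
  rw [demandLaw, integral_withDensity_eq_integral_toReal_smul h.measurable.ennreal_ofReal
    (Filter.Eventually.of_forall fun _ => ENNReal.ofReal_lt_top)]
  refine integral_congr_ae (Filter.Eventually.of_forall fun y => ?_)
  simp [ENNReal.toReal_ofReal (h.nonneg y)]

theorem integrable_iff (h : DemandDensity f L B) (φ : ℝ → ℝ) :
    Integrable φ (demandLaw f) ↔ Integrable (fun y => f y * φ y) := by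
  rw [demandLaw, integrable_withDensity_iff_integrable_smul' h.measurable.ennreal_ofReal
    (Filter.Eventually.of_forall fun _ => ENNReal.ofReal_lt_top)]
  refine integrable_congr (Filter.Eventually.of_forall fun y => ?_)
  simp [ENNReal.toReal_ofReal (h.nonneg y)]

theorem ae_nonneg (h : DemandDensity f L B) : ∀ᵐ y ∂demandLaw f, 0 ≤ y := by
  rw [demandLaw, ae_withDensity_iff h.measurable.ennreal_ofReal]
  refine Filter.Eventually.of_forall fun y hy => ?_
  by_contra hcon
  exact hy (by rw [h.neg y (not_le.1 hcon), ENNReal.ofReal_zero])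

/-- A density bounded by 0 would have total mass 0. This makes L cmax + B positive, so it may stand
in a denominator. -/
theorem bound_pos (h : DemandDensity f L B) : 0 < B := by
  by_contra hcon
  have hf : ∀ y, f y = 0 := fun y => by
    rcases lt_or_ge y 0 with hy | hy
    · exact h.neg y hy
    · exact abs_eq_zero.1 (le_antisymm ((h.bdd y hy).trans (not_lt.1 hcon)) (abs_nonneg _))
  have h1 : demandLaw f = 0 := by simp [demandLaw, hf]
  have := h.prob.measure_univ
  simp [h1] at this

end DemandDensity

namespace Tame

variable {cmax N : ℝ} {V : ℝ → ℝ}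

theorem lipschitzWith (hV : Tame cmax N V) : LipschitzWith (Real.nnabs N) V :=
  LipschitzWith.of_dist_le_mul fun x y => by
    rw [Real.dist_eq, Real.dist_eq]
    refine (hV.lip x y).trans ?_
    gcongr
    exact le_abs_self N

/-- The constant extension absorbs the truncation of lost sales: V((z - y)⁺) = V(z - y), which turns
the expectation into a convolution. -/
theorem max_zero_eq (hV : Tame cmax N V) (x : ℝ) : V (max x 0) = V x := by
  rw [← hV.clamp_eq x, ← hV.clamp_eq (max x 0)]
  congr 1
  unfold clamp
  rcases max_cases x 0 with ⟨h, h'⟩ | ⟨h, h'⟩ <;> rw [h]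
  rw [max_eq_left (min_le_left _ _), max_eq_left ((min_le_left _ _).trans h'.le)]

theorem abs_deriv_le (hV : Tame cmax N V) (hN : 0 ≤ N) (x : ℝ) : |deriv V x| ≤ N := by
  have := norm_deriv_le_of_lipschitz hV.lipschitzWith (x₀ := x)
  rwa [Real.norm_eq_abs, Real.coe_nnabs, abs_of_nonneg hN] at this

theorem deriv_of_neg (hV : Tame cmax N V) {x : ℝ} (hx : x < 0) : deriv V x = 0 := by
  have : V =ᶠ[nhds x] fun _ => V 0 := by
    filter_upwards [Iio_mem_nhds hx] with y hy
    rw [← hV.max_zero_eq y, max_eq_right (le_of_lt hy)]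
  rw [this.deriv_eq, deriv_const]

theorem abs_sub_zero_le (hV : Tame cmax N V) (h0 : 0 ≤ cmax) (hN : 0 ≤ N) (x : ℝ) :
    |V x - V 0| ≤ N * cmax := by
  rw [← hV.clamp_eq x]
  refine (hV.lip _ _).trans (mul_le_mul_of_nonneg_left ?_ hN)
  have := clamp_mem h0 x
  rw [sub_zero, abs_of_nonneg this.1]
  exact this.2

theorem integrable (hV : Tame cmax N V) (h0 : 0 ≤ cmax) (hN : 0 ≤ N) (ν : Measure ℝ)
    [IsFiniteMeasure ν] (z : ℝ) : Integrable (fun y => V (z - y)) ν := by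
  refine Integrable.of_bound (C := |V 0| + N * cmax)
    (hV.lipschitzWith.continuous.comp (by fun_prop)).aestronglyMeasurable
    (Filter.Eventually.of_forall fun y => ?_)
  have h1 := hV.abs_sub_zero_le h0 hN (z - y)
  have h2 := abs_add_le (V 0) (V (z - y) - V 0)
  rw [add_sub_cancel] at h2
  rw [Real.norm_eq_abs]
  linarith

end Tame

/-- Expectation of `V` after subtraction of a random demand. -/
def expect (f : ℝ → ℝ) (V : ℝ → ℝ) (z : ℝ) : ℝ := ∫ y, V (z - y) ∂demandLaw f

/-- Derivative of `expect f V`. -/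
def expectDeriv (f : ℝ → ℝ) (V : ℝ → ℝ) (z : ℝ) : ℝ := ∫ y, deriv V (z - y) ∂demandLaw f

section Expect

variable {f : ℝ → ℝ} {L B cmax N : ℝ} {V : ℝ → ℝ}

/-- V may have kinks, but a Lipschitz function is differentiable almost everywhere and the demand
law is absolutely continuous. For fixed z, the point z - y therefore avoids the kinks for almost
every demand y, and dominated differentiation applies. -/
theorem hasDerivAt_expect (hf : DemandDensity f L B) (hV : Tame cmax N V) (h0 : 0 ≤ cmax)
    (hN : 0 ≤ N) (z : ℝ) : HasDerivAt (expect f V) (expectDeriv f V z) z := by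
  have := hf.prob
  refine (hasDerivAt_integral_of_dominated_loc_of_lip (bound := fun _ => N)
    (F := fun z y => V (z - y)) (F' := fun y => deriv V (z - y)) (μ := demandLaw f)
    Filter.univ_mem ?_ (hV.integrable h0 hN _ z) ?_ ?_ (integrable_const _) ?_).2
  · exact Filter.Eventually.of_forall fun z =>
      (hV.lipschitzWith.continuous.comp (by fun_prop)).aestronglyMeasurable
  · exact ((measurable_deriv V).comp (by fun_prop)).aestronglyMeasurable
  · refine Filter.Eventually.of_forall fun y => LipschitzWith.lipschitzOnWith ?_
    refine LipschitzWith.of_dist_le_mul fun a b => ?_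
    have := hV.lipschitzWith.dist_le_mul (a - y) (b - y)
    rwa [dist_sub_right] at this
  · refine (withDensity_absolutelyContinuous _ _ : demandLaw f ≪ volume).ae_le ?_
    have h1 := hV.lipschitzWith.ae_differentiableAt_of_real (μ := (volume : Measure ℝ))
    have h2 := (Measure.measurePreserving_sub_left (volume : Measure ℝ) z).quasiMeasurePreserving.ae h1
    filter_upwards [h2] with y hy
    simpa using hy.hasDerivAt.comp_sub_const z y

theorem abs_expectDeriv_le (hf : DemandDensity f L B) (hV : Tame cmax N V) (hN : 0 ≤ N) (z : ℝ) :
    |expectDeriv f V z| ≤ N := by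
  have := hf.prob
  have := norm_integral_le_of_norm_le_const (μ := demandLaw f) (f := fun y => deriv V (z - y))
    (Filter.Eventually.of_forall fun y => hV.abs_deriv_le hN (z - y))
  simpa [expectDeriv] using this

/-- The substitution x = z - y moves the dependence on z from V', which is only bounded, to the
density, which is Lipschitz on the half-line. -/
theorem expectDeriv_eq (hf : DemandDensity f L B) (z : ℝ) :
    expectDeriv f V z = ∫ x, f (z - x) * deriv V x := by
  rw [expectDeriv, hf.integral_eq, ← integral_sub_left_eq_self _ volume z]
  simp

theorem integrable_density_mul_deriv (hf : DemandDensity f L B) (hV : Tame cmax N V) (hN : 0 ≤ N)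
    (z : ℝ) : Integrable fun x => f (z - x) * deriv V x := by
  have := hf.prob
  have h1 : Integrable (fun y => deriv V (z - y)) (demandLaw f) :=
    Integrable.of_bound ((measurable_deriv V).comp (by fun_prop)).aestronglyMeasurable N
      (Filter.Eventually.of_forall fun y => hV.abs_deriv_le hN (z - y))
  simpa using ((hf.integrable_iff _).1 h1).comp_sub_left z

/-- The integrand is split by x. On [0, z] both density values lie in the Lipschitz range and differ
by at most L(z' - z). On (z, z'] only f(z' - x) ≤ B survives, which accounts for the possible jump
of f at 0. For x < 0 the derivative of V vanishes, and for x > z' both densities do. -/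
theorem expectDeriv_lipschitz_of_le (hf : DemandDensity f L B) (hV : Tame cmax N V) (hN : 0 ≤ N)
    {z z' : ℝ} (hz : 0 ≤ z) (hzz : z ≤ z') (hz' : z' ≤ cmax) :
    |expectDeriv f V z - expectDeriv f V z'| ≤ (L * cmax + B) * N * (z' - z) := by
  rw [expectDeriv_eq hf, expectDeriv_eq hf, ← integral_sub
    (integrable_density_mul_deriv hf hV hN z) (integrable_density_mul_deriv hf hV hN z')]
  have i1 : Integrable ((Set.Icc 0 z).indicator fun _ : ℝ => L * (z' - z) * N) :=
    (integrable_indicator_iff measurableSet_Icc).2 (integrableOn_const (by simp))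
  have i2 : Integrable ((Set.Ioc z z').indicator fun _ : ℝ => B * N) :=
    (integrable_indicator_iff measurableSet_Ioc).2 (integrableOn_const (by simp))
  have hle := norm_integral_le_of_norm_le (i1.add i2)
    (f := fun x => f (z - x) * deriv V x - f (z' - x) * deriv V x)
    (Filter.Eventually.of_forall fun x => ?_)
  · rw [Real.norm_eq_abs] at hle
    refine hle.trans ?_
    rw [integral_add' i1 i2, integral_indicator measurableSet_Icc,
      integral_indicator measurableSet_Ioc, setIntegral_const, setIntegral_const]
    simp only [Measure.real, Real.volume_Icc, Real.volume_Ioc, smul_eq_mul]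
    rw [ENNReal.toReal_ofReal (by linarith), ENNReal.toReal_ofReal (by linarith)]
    -- The first interval has length z, which is enlarged to cmax to obtain a uniform constant.
    have : 0 ≤ L * (z' - z) * N * (cmax - z) :=
      mul_nonneg (mul_nonneg (mul_nonneg hf.L_nonneg (by linarith)) hN) (by linarith)
    linarith
  · have hd := hV.abs_deriv_le hN x
    rw [Real.norm_eq_abs, ← sub_mul, abs_mul]
    simp only [Pi.add_apply]
    rcases lt_or_ge x 0 with hx | hx
    · rw [hV.deriv_of_neg hx, Set.indicator_of_notMem (fun h => not_le.2 hx h.1),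
        Set.indicator_of_notMem (fun h => not_le.2 hx (hz.trans h.1.le))]
      simp
    rcases le_or_gt x z with hxz | hxz
    · rw [Set.indicator_of_mem (show x ∈ Set.Icc 0 z from ⟨hx, hxz⟩),
        Set.indicator_of_notMem (fun h => not_le.2 h.1 hxz), add_zero]
      have := hf.lip (z - x) (by linarith) (z' - x) (by linarith)
      rw [sub_sub_sub_cancel_right, abs_of_nonpos (by linarith : z - z' ≤ 0), neg_sub] at this
      exact mul_le_mul this hd (abs_nonneg _) (mul_nonneg hf.L_nonneg (by linarith))
    · rw [Set.indicator_of_notMem (fun h => not_le.2 hxz h.2), zero_add,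
        hf.neg (z - x) (by linarith), zero_sub, abs_neg]
      rcases le_or_gt x z' with hxz' | hxz'
      · rw [Set.indicator_of_mem (show x ∈ Set.Ioc z z' from ⟨hxz, hxz'⟩)]
        exact mul_le_mul (hf.bdd _ (by linarith)) hd (abs_nonneg _) hf.bound_pos.le
      · rw [Set.indicator_of_notMem (fun h => not_le.2 hxz' h.2), hf.neg (z' - x) (by linarith)]
        simp

theorem expectDeriv_lipschitz (hf : DemandDensity f L B) (hV : Tame cmax N V) (hN : 0 ≤ N)
    {z z' : ℝ} (hz : z ∈ Set.Icc 0 cmax) (hz' : z' ∈ Set.Icc 0 cmax) :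
    |expectDeriv f V z - expectDeriv f V z'| ≤ (L * cmax + B) * N * |z - z'| := by
  rcases le_total z z' with h | h
  · rw [abs_of_nonpos (by linarith : z - z' ≤ 0), neg_sub]
    exact expectDeriv_lipschitz_of_le hf hV hN hz.1 h hz'.2
  · rw [abs_of_nonneg (by linarith : 0 ≤ z - z'), abs_sub_comm]
    exact expectDeriv_lipschitz_of_le hf hV hN hz'.1 h hz.2

/-- A strongly convex function stays convex after adding a function whose derivative is
Lipschitz with a smaller constant. -/
theorem convexOn_add_of_lipschitz_deriv {cmax m : ℝ} {h h' h'' p p' : ℝ → ℝ}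
    (hh : ∀ z ∈ Set.Icc 0 cmax, HasDerivWithinAt h (h' z) (Set.Icc 0 cmax) z)
    (hh' : ∀ z ∈ Set.Icc 0 cmax, HasDerivWithinAt h' (h'' z) (Set.Icc 0 cmax) z)
    (hm : ∀ z ∈ Set.Icc 0 cmax, m ≤ h'' z)
    (hp : ∀ z ∈ Set.Icc 0 cmax, HasDerivWithinAt p (p' z) (Set.Icc 0 cmax) z)
    (hp' : ∀ x ∈ Set.Icc 0 cmax, ∀ y ∈ Set.Icc 0 cmax, |p' x - p' y| ≤ m * |x - y|) :
    ConvexOn ℝ (Set.Icc 0 cmax) fun z => h z + p z := by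
  -- The slope h' grows at rate at least m, while p' decreases at rate at most m, so their sum is
  -- nondecreasing.
  have hmono : MonotoneOn (fun z => h' z - m * z) (Set.Icc 0 cmax) := by
    refine monotoneOn_of_hasDerivWithinAt_nonneg (f' := fun z => h'' z - m) (convex_Icc _ _) ?_ ?_ ?_
    · intro z hz
      exact ((hh' z hz).continuousWithinAt).sub (by fun_prop)
    · intro z hz
      have := (hh' z (interior_subset hz)).sub
        (((hasDerivWithinAt_id z (Set.Icc 0 cmax)).const_mul m))
      rw [mul_one] at this
      exact this.mono interior_subset
    · intro z hz
      linarith [hm z (interior_subset hz)]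
  refine MonotoneOn.convexOn_of_deriv (convex_Icc _ _)
    (fun z hz => ((hh z hz).add (hp z hz)).continuousWithinAt) ?_ ?_
  · intro z hz
    exact (((hh z (interior_subset hz)).add (hp z (interior_subset hz))).hasDerivAt
      (mem_interior_iff_mem_nhds.1 hz)).differentiableAt.differentiableWithinAt
  · intro x hx y hy hxy
    have e : ∀ z ∈ interior (Set.Icc 0 cmax), deriv (fun z => h z + p z) z = h' z + p' z :=
      fun z hz => (((hh z (interior_subset hz)).add (hp z (interior_subset hz))).hasDerivAt
        (mem_interior_iff_mem_nhds.1 hz)).deriv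
    rw [e x hx, e y hy]
    have h1 := hmono (interior_subset hx) (interior_subset hy) hxy
    have h2 := (abs_le.1 (hp' x (interior_subset hx) y (interior_subset hy))).2
    rw [abs_of_nonpos (by linarith : x - y ≤ 0)] at h2
    simp only at h1
    linarith

theorem abs_sub_le_of_hasDerivWithinAt {cmax C : ℝ} {φ φ' : ℝ → ℝ}
    (h : ∀ z ∈ Set.Icc 0 cmax, HasDerivWithinAt φ (φ' z) (Set.Icc 0 cmax) z ∧ |φ' z| ≤ C) :
    ∀ x ∈ Set.Icc 0 cmax, ∀ y ∈ Set.Icc 0 cmax, |φ x - φ y| ≤ C * |x - y| := fun _ hx _ hy =>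
  (convex_Icc 0 cmax).norm_image_sub_le_of_norm_hasDerivWithin_le (fun z hz => (h z hz).1)
    (fun z hz => (h z hz).2) hy hx

end Expect

/-! ### The backward recursion and the fixed point in the reset cost. -/

/-- Lipschitz constant of the cost-to-go at time `t`. -/
def lipBound (k : ℕ) (cmax c L B : ℝ) (κ m η : ℕ → ℝ) (t : ℕ) : ℝ :=
  if t = k then η t else η t + c + κ t + m t / (L * cmax + B)

/-- The assumptions that do not refer to the probability space. -/
structure Setup (M : Problem) (f : ℝ → ℝ) (cmax c K L B : ℝ) (H : ℝ → ℕ → ℝ) (κ m η : ℕ → ℝ) :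
    Prop where
  one_le : 1 ≤ M.k
  γ_nonneg : 0 ≤ M.γ
  γ_lt : M.γ < 1
  dynamics : A1 M
  stage : A2 M f cmax c K H κ m
  reset : A3 M f cmax η
  input : A4 M cmax
  density : DemandDensity f L B
  γ_le : ∀ t < M.k, M.γ * ((L * cmax + B) * lipBound M.k cmax c L B κ m η (t + 1)) ≤ m t

/-- Expected cost-to-go after an order up to `z` at time `t`, with terminal costs `V`. -/
def contCost (M : Problem) (f : ℝ → ℝ) (H : ℝ → ℕ → ℝ) (V : ℝ → ℝ) (t : ℕ) (z : ℝ) : ℝ :=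
  H z t + M.γ * expect f V z

/-- Solutions of the backward recursion with cost `lam + R` for a reset. -/
structure IsSolution (M : Problem) (f : ℝ → ℝ) (cmax c K : ℝ) (H : ℝ → ℕ → ℝ) (N : ℕ → ℝ)
    (lam : ℝ) (V : ℕ → ℝ → ℝ) : Prop where
  measurable : ∀ t, Measurable (V t)
  tame : ∀ t ≤ M.k, Tame cmax (N t) (V t)
  terminal : ∀ x ∈ Set.Icc 0 cmax, V M.k x = lam + M.R f x M.k
  le_reset : ∀ t ≤ M.k, ∀ x ∈ Set.Icc 0 cmax, V t x ≤ lam + M.R f x t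
  le_order : ∀ t < M.k, ∀ x ∈ Set.Icc 0 cmax, ∀ u ∈ Set.Icc 0 (cmax - x),
    V t x ≤ orderCost c K (contCost M f H (V (t + 1)) t) x u
  threshold : ∀ t < M.k, ∃ S σ s Sig, ThresholdForm cmax c K lam (fun x => M.R f x t)
    (contCost M f H (V (t + 1)) t) (V t) S σ s Sig

/-- A recursion that runs downward from k is obtained from an upward one through the index j = k -
t. Truncated subtraction makes the sequence constant from k on. -/
theorem exists_backward_sequence {α : Type*} {k : ℕ} {P : ℕ → α → Prop} {Q : ℕ → α → α → Prop}
    (h : ∀ t < k, ∀ a, P (t + 1) a → ∃ b, P t b ∧ Q t b a) {a₀ : α} (h₀ : P k a₀) :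
    ∃ V : ℕ → α, (∀ t, k ≤ t → V t = a₀) ∧ (∀ t ≤ k, P t (V t)) ∧ ∀ t < k, Q t (V t) (V (t + 1)) := by
  have h' : ∀ t a, ∃ b, t < k → P (t + 1) a → P t b ∧ Q t b a := by
    intro t a
    by_cases ht : t < k ∧ P (t + 1) a
    · obtain ⟨b, hb⟩ := h t ht.1 a ht.2
      exact ⟨b, fun _ _ => hb⟩
    -- An arbitrary value outside the range of the step, so that the choice function is total.
    · exact ⟨a, fun h1 h2 => absurd ⟨h1, h2⟩ ht⟩
  choose F hF using h'
  let U : ℕ → α := fun j => Nat.rec a₀ (fun j a => F (k - (j + 1)) a) j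
  have hU : ∀ t < k, U (k - t) = F t (U (k - (t + 1))) := fun t ht => by
    obtain ⟨j, hj⟩ : ∃ j, k - t = j + 1 := ⟨k - t - 1, by omega⟩
    have h1 : k - (t + 1) = j := by omega
    have h2 : k - (j + 1) = t := by omega
    rw [hj, h1]
    change F (k - (j + 1)) (U j) = _
    rw [h2]
  have hP : ∀ t ≤ k, P t (U (k - t)) := by
    intro t ht
    induction ht using Nat.decreasingInduction with
    | self => simpa [U] using h₀
    | of_succ t ht ih =>
      rw [hU t ht]
      exact (hF t _ ht ih).1
  refine ⟨fun t => U (k - t), fun t ht => by simp [U, Nat.sub_eq_zero_of_le ht], hP, fun t ht => ?_⟩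
  have := (hF t _ ht (hP (t + 1) ht)).2
  rwa [← hU t ht] at this

/-- Each piece exhibits a decision that realizes the value, so the upper bounds in `IsSolution` are
sharp and two solutions can be compared decision by decision. -/
theorem ThresholdForm.attained {cmax c K lam : ℝ} {R G V : ℝ → ℝ} {S : ℝ} {σ s Sig : EReal}
    (h : ThresholdForm cmax c K lam R G V S σ s Sig) {x : ℝ} (hx : x ∈ Set.Icc 0 cmax) :
    V x = lam + R x ∨ ∃ u ∈ Set.Icc 0 (cmax - x), V x = orderCost c K G x u := by
  rcases lt_or_ge (x : EReal) σ with h1 | h1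
  · exact Or.inl (h.low x hx h1)
  rcases lt_or_ge (x : EReal) s with h2 | h2
  · obtain ⟨h3, h4⟩ := h.order x hx h1 h2
    refine Or.inr ⟨S - x, ⟨by linarith, by linarith [h.S_mem.2]⟩, ?_⟩
    rw [h4, orderCost, if_pos (by linarith), mul_one, add_sub_cancel]
  rcases lt_or_ge (x : EReal) Sig with h3 | h3
  · refine Or.inr ⟨0, ⟨le_rfl, by linarith [hx.2]⟩, ?_⟩
    simp [orderCost, h.idle x hx h2 h3]
  · exact Or.inl (h.high x hx h3)

theorem expect_le_of_le {f : ℝ → ℝ} {L B cmax N N' a : ℝ} {V V' : ℝ → ℝ}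
    (hf : DemandDensity f L B) (h0 : 0 ≤ cmax) (hV : Tame cmax N V) (hV' : Tame cmax N' V')
    (hN : 0 ≤ N) (hN' : 0 ≤ N') (h : ∀ x ∈ Set.Icc 0 cmax, V x ≤ V' x + a) (z : ℝ) :
    expect f V z ≤ expect f V' z + a := by
  have := hf.prob
  have h1 : ∫ y, (V' (z - y) + a) ∂demandLaw f = expect f V' z + a := by
    rw [integral_add (hV'.integrable h0 hN' _ z) (integrable_const _)]
    simp [expect]
  rw [← h1]
  refine integral_mono (hV.integrable h0 hN _ z)
    ((hV'.integrable h0 hN' _ z).add (integrable_const _)) fun y => ?_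
  have := h _ (clamp_mem h0 (z - y))
  rwa [hV.clamp_eq, hV'.clamp_eq] at this

theorem le_expect_of_le {f : ℝ → ℝ} {L B cmax N a : ℝ} {V : ℝ → ℝ}
    (hf : DemandDensity f L B) (h0 : 0 ≤ cmax) (hV : Tame cmax N V)
    (hN : 0 ≤ N) (h : ∀ x ∈ Set.Icc 0 cmax, a ≤ V x) (z : ℝ) : a ≤ expect f V z := by
  have := hf.prob
  have h1 : ∫ _, a ∂demandLaw f = a := by simp
  rw [← h1]
  refine integral_mono (integrable_const _) (hV.integrable h0 hN _ z) fun y => ?_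
  have := h _ (clamp_mem h0 (z - y))
  rwa [hV.clamp_eq] at this

namespace Setup

variable {M : Problem} {f : ℝ → ℝ} {cmax c K L B : ℝ} {H : ℝ → ℕ → ℝ} {κ m η : ℕ → ℝ}

theorem cmax_nonneg (h : Setup M f cmax c K L B H κ m η) : 0 ≤ cmax := h.input.1

theorem zero_mem (h : Setup M f cmax c K L B H κ m η) : (0 : ℝ) ∈ Set.Icc 0 cmax :=
  ⟨le_rfl, h.cmax_nonneg⟩

theorem modulus_pos (h : Setup M f cmax c K L B H κ m η) : 0 < L * cmax + B :=
  add_pos_of_nonneg_of_pos (mul_nonneg h.density.L_nonneg h.cmax_nonneg) h.density.bound_pos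

theorem η_nonneg (h : Setup M f cmax c K L B H κ m η) {t : ℕ} (ht : t ≤ M.k) : 0 ≤ η t := by
  obtain ⟨φ', hφ⟩ := h.reset.deriv_bdd t ht
  exact (abs_nonneg _).trans (hφ 0 h.zero_mem).2

theorem κ_nonneg (h : Setup M f cmax c K L B H κ m η) {t : ℕ} (ht : t < M.k) : 0 ≤ κ t := by
  obtain ⟨H', H'', hH⟩ := h.stage.deriv_H t ht
  exact (abs_nonneg _).trans (hH 0 h.zero_mem).2.2.1

theorem slope_nonneg (h : Setup M f cmax c K L B H κ m η) {t : ℕ} (ht : t < M.k) :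
    0 ≤ m t / (L * cmax + B) :=
  div_nonneg (h.stage.m_pos t ht).le h.modulus_pos.le

theorem lipBound_nonneg (h : Setup M f cmax c K L B H κ m η) {t : ℕ} (ht : t ≤ M.k) :
    0 ≤ lipBound M.k cmax c L B κ m η t := by
  have h1 := h.η_nonneg ht
  unfold lipBound
  split_ifs with hk
  · exact h1
  · have ht' := lt_of_le_of_ne ht hk
    have h2 := h.κ_nonneg ht'
    have h3 := h.slope_nonneg ht'
    have h4 := h.stage.c_nonneg
    positivity

theorem γ_mul_lipBound_le (h : Setup M f cmax c K L B H κ m η) {t : ℕ} (ht : t < M.k) :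
    M.γ * lipBound M.k cmax c L B κ m η (t + 1) ≤ m t / (L * cmax + B) := by
  rw [le_div_iff₀ h.modulus_pos]
  linarith [h.γ_le t ht]

theorem R_nonneg (M : Problem) (f : ℝ → ℝ) (x : ℝ) (t : ℕ) : 0 ≤ M.R f x t :=
  integral_nonneg fun _ => NNReal.coe_nonneg _

theorem R_lipschitz (h : Setup M f cmax c K L B H κ m η) {t : ℕ} (ht : t ≤ M.k) :
    ∀ x ∈ Set.Icc 0 cmax, ∀ y ∈ Set.Icc 0 cmax, |M.R f x t - M.R f y t| ≤ η t * |x - y| := by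
  obtain ⟨φ', hφ⟩ := h.reset.deriv_bdd t ht
  exact abs_sub_le_of_hasDerivWithinAt hφ

theorem contCost_hasDeriv (h : Setup M f cmax c K L B H κ m η) {t : ℕ} (ht : t < M.k)
    {V : ℝ → ℝ} (hV : Tame cmax (lipBound M.k cmax c L B κ m η (t + 1)) V) {H' : ℝ → ℝ}
    {z : ℝ} (hz : HasDerivWithinAt (fun y => H y t) (H' z) (Set.Icc 0 cmax) z) :
    HasDerivWithinAt (contCost M f H V t) (H' z + M.γ * expectDeriv f V z) (Set.Icc 0 cmax) z :=
  hz.add ((hasDerivAt_expect h.density hV h.cmax_nonneg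
    (h.lipBound_nonneg ht) z).hasDerivWithinAt.const_mul M.γ)

theorem abs_γ_mul_expectDeriv_le (h : Setup M f cmax c K L B H κ m η) {t : ℕ} (ht : t < M.k)
    {V : ℝ → ℝ} (hV : Tame cmax (lipBound M.k cmax c L B κ m η (t + 1)) V) (z : ℝ) :
    |M.γ * expectDeriv f V z| ≤ m t / (L * cmax + B) := by
  rw [abs_mul, abs_of_nonneg h.γ_nonneg]
  exact (mul_le_mul_of_nonneg_left (abs_expectDeriv_le h.density hV (h.lipBound_nonneg ht) z)
    h.γ_nonneg).trans (h.γ_mul_lipBound_le ht)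

theorem γ_mul_expectDeriv_lipschitz (h : Setup M f cmax c K L B H κ m η) {t : ℕ} (ht : t < M.k)
    {V : ℝ → ℝ} (hV : Tame cmax (lipBound M.k cmax c L B κ m η (t + 1)) V) {x y : ℝ}
    (hx : x ∈ Set.Icc 0 cmax) (hy : y ∈ Set.Icc 0 cmax) :
    |M.γ * expectDeriv f V x - M.γ * expectDeriv f V y| ≤ m t * |x - y| := by
  rw [← mul_sub, abs_mul, abs_of_nonneg h.γ_nonneg]
  have h1 := mul_le_mul_of_nonneg_left
    (expectDeriv_lipschitz h.density hV (h.lipBound_nonneg ht) hx hy) h.γ_nonneg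
  have h2 := mul_le_mul_of_nonneg_right (h.γ_le t ht) (abs_nonneg (x - y))
  linarith

/-- The induction step of the recursion: the only property taken over from time t + 1 is `Tame`, and
convexity of the continuation cost is created afresh at each step from H. -/
theorem exists_step (h : Setup M f cmax c K L B H κ m η) (lam : ℝ) {t : ℕ} (ht : t < M.k)
    {V : ℝ → ℝ} (hV : Tame cmax (lipBound M.k cmax c L B κ m η (t + 1)) V) :
    ∃ V' : ℝ → ℝ, Tame cmax (lipBound M.k cmax c L B κ m η t) V' ∧
      (∀ x ∈ Set.Icc 0 cmax, V' x ≤ lam + M.R f x t) ∧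
      (∀ x ∈ Set.Icc 0 cmax, ∀ u ∈ Set.Icc 0 (cmax - x),
        V' x ≤ orderCost c K (contCost M f H V t) x u) ∧
      ∃ S σ s Sig, ThresholdForm cmax c K lam (fun x => M.R f x t) (contCost M f H V t) V'
        S σ s Sig := by
  obtain ⟨H', H'', hH⟩ := h.stage.deriv_H t ht
  have hconv : ConvexOn ℝ (Set.Icc 0 cmax) (contCost M f H V t) :=
    convexOn_add_of_lipschitz_deriv (fun z hz => (hH z hz).1) (fun z hz => (hH z hz).2.1)
      (fun z hz => (hH z hz).2.2.2)
      (fun z _ => ((hasDerivAt_expect h.density hV h.cmax_nonneg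
        (h.lipBound_nonneg ht) z).const_mul M.γ).hasDerivWithinAt)
      (fun x hx y hy => h.γ_mul_expectDeriv_lipschitz ht hV hx hy)
  have hlip := abs_sub_le_of_hasDerivWithinAt (φ := contCost M f H V t)
    (C := κ t + m t / (L * cmax + B)) fun z hz => ⟨h.contCost_hasDeriv ht hV (hH z hz).1,
      (abs_add_le _ _).trans (add_le_add (hH z hz).2.2.1 (h.abs_γ_mul_expectDeriv_le ht hV z))⟩
  have := exists_thresholdForm (lam := lam) h.cmax_nonneg h.stage.c_nonneg h.stage.K_nonneg
    (h.η_nonneg ht.le) (add_nonneg (h.κ_nonneg ht) (h.slope_nonneg ht))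
    (h.reset.concave t ht.le) (h.reset.mono t ht.le) (h.R_lipschitz ht.le) hconv hlip
  rwa [show η t + c + (κ t + m t / (L * cmax + B)) = lipBound M.k cmax c L B κ m η t by
    rw [lipBound, if_neg ht.ne]; ring] at this

theorem exists_solution (h : Setup M f cmax c K L B H κ m η) (lam : ℝ) :
    ∃ V, IsSolution M f cmax c K H (lipBound M.k cmax c L B κ m η) lam V := by
  have h₀ : Tame cmax (lipBound M.k cmax c L B κ m η M.k)
      (fun x => lam + M.R f (clamp cmax x) M.k) :=
    Tame.comp_clamp (V := fun x => lam + M.R f x M.k) h.cmax_nonneg (h.lipBound_nonneg le_rfl)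
      fun x hx y hy => by
        rw [add_sub_add_left_eq_sub, lipBound, if_pos rfl]
        exact h.R_lipschitz le_rfl x hx y hy
  obtain ⟨V, hVk, hV, hQ⟩ := exists_backward_sequence
    (fun t ht V hV => h.exists_step lam ht (V := V) hV) h₀
  have hterm : ∀ x ∈ Set.Icc 0 cmax, V M.k x = lam + M.R f x M.k := fun x hx => by
    simp only [hVk _ le_rfl, clamp_of_mem hx]
  have hmeas : ∀ t, Measurable (V t) := fun t => by
    rcases le_total t M.k with ht | ht
    · exact (hV t ht).lipschitzWith.continuous.measurable
    · exact hVk t ht ▸ h₀.lipschitzWith.continuous.measurable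
  refine ⟨V, hmeas, hV, hterm, fun t ht x hx => ?_, fun t ht => (hQ t ht).2.1, fun t ht => (hQ t ht).2.2⟩
  rcases ht.eq_or_lt with rfl | ht
  · exact (hterm x hx).le
  · exact (hQ t ht).1 x hx

/-- The decision that is optimal for V' is used in the problem for V. After a reset the costs differ
by lam - lam'; after an order the gap is the inductive one, discounted by γ. -/
theorem solution_le (h : Setup M f cmax c K L B H κ m η) {lam lam' : ℝ} {V V' : ℕ → ℝ → ℝ}
    (hV : IsSolution M f cmax c K H (lipBound M.k cmax c L B κ m η) lam V)
    (hV' : IsSolution M f cmax c K H (lipBound M.k cmax c L B κ m η) lam' V')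
    {t : ℕ} (ht : t ≤ M.k) : ∀ x ∈ Set.Icc 0 cmax, V t x ≤ V' t x + |lam - lam'| := by
  have hl := le_abs_self (lam - lam')
  induction ht using Nat.decreasingInduction with
  | self =>
    intro x hx
    rw [hV.terminal x hx, hV'.terminal x hx]
    linarith
  | of_succ t ht ih =>
    intro x hx
    obtain ⟨S, σ, s, Sig, hT⟩ := hV'.threshold t ht
    rcases hT.attained hx with h1 | ⟨u, hu, h1⟩
    · rw [h1]
      linarith [hV.le_reset t ht.le x hx]
    · rw [h1]
      refine (hV.le_order t ht x hx u hu).trans ?_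
      have h2 := expect_le_of_le h.density h.cmax_nonneg (hV.tame _ ht) (hV'.tame _ ht)
        (h.lipBound_nonneg ht) (h.lipBound_nonneg ht) ih (x + u)
      have h3 := mul_le_mul_of_nonneg_left h2 h.γ_nonneg
      have h4 := mul_le_of_le_one_left (abs_nonneg (lam - lam')) h.γ_lt.le
      simp only [orderCost, contCost]
      linarith

theorem stage_nonneg (h : Setup M f cmax c K L B H κ m η) {t : ℕ} (ht : t < M.k) {x u : ℝ}
    (hx : x ∈ Set.Icc 0 cmax) (hu : u ∈ Set.Icc 0 (cmax - x)) :
    0 ≤ c * u + K * (if 0 < u then 1 else 0) + H (x + u) t := by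
  rw [← h.stage.expect_eq t ht x hx u hu]
  exact integral_nonneg fun _ => NNReal.coe_nonneg _

/-- All costs are nonnegative apart from `lam`, whose sign is still unknown at this stage.
Discounting can only raise the nonpositive number `min lam 0`. -/
theorem min_le_solution (h : Setup M f cmax c K L B H κ m η) {lam : ℝ} {V : ℕ → ℝ → ℝ}
    (hV : IsSolution M f cmax c K H (lipBound M.k cmax c L B κ m η) lam V)
    {t : ℕ} (ht : t ≤ M.k) : ∀ x ∈ Set.Icc 0 cmax, min lam 0 ≤ V t x := by
  have hl := min_le_left lam 0
  induction ht using Nat.decreasingInduction with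
  | self =>
    intro x hx
    rw [hV.terminal x hx]
    linarith [R_nonneg M f x M.k]
  | of_succ t ht ih =>
    intro x hx
    obtain ⟨S, σ, s, Sig, hT⟩ := hV.threshold t ht
    rcases hT.attained hx with h1 | ⟨u, hu, h1⟩
    · rw [h1]
      linarith [R_nonneg M f x t]
    · have h2 := le_expect_of_le h.density h.cmax_nonneg (hV.tame _ ht) (h.lipBound_nonneg ht)
        ih (x + u)
      have h3 := mul_le_mul_of_nonneg_left h2 h.γ_nonneg
      have h4 : min lam 0 ≤ M.γ * min lam 0 := by
        nlinarith [min_le_right lam 0, h.γ_lt]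
      have h5 := h.stage_nonneg ht hx hu
      rw [h1]
      simp only [orderCost, contCost]
      linarith

/-- The recursion closes up for exactly the reset cost that it generates at time `0`. -/
theorem exists_fixed_solution (h : Setup M f cmax c K L B H κ m η) :
    ∃ lam V, IsSolution M f cmax c K H (lipBound M.k cmax c L B κ m η) lam V ∧ 0 ≤ lam ∧
      (∀ u ∈ Set.Icc 0 cmax, lam ≤ orderCost c K (contCost M f H (V 1) 0) 0 u) ∧
      ∃ φ ∈ Set.Icc 0 cmax, lam = orderCost c K (contCost M f H (V 1) 0) 0 φ := by
  have h1k : 0 < M.k := h.one_le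
  choose V hV using h.exists_solution
  have hcont : ∀ lam, ContinuousOn (contCost M f H (V lam 1) 0) (Set.Icc 0 cmax) := by
    intro lam z hz
    obtain ⟨H', H'', hH⟩ := h.stage.deriv_H 0 h1k
    exact (h.contCost_hasDeriv h1k ((hV lam).tame 1 h.one_le) (hH z hz).1).continuousWithinAt
  choose φ hφ hφmin using fun lam =>
    exists_optimal_order (c := c) h.cmax_nonneg h.stage.K_nonneg (hcont lam)
  -- The optimal cost from (0,0) when the first decision is not a reset and every later reset is
  -- charged `lam`.
  set W : ℝ → ℝ := fun lam => orderCost c K (contCost M f H (V lam 1) 0) 0 (φ lam) with hW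
  have hle : ∀ a b, W a ≤ W b + M.γ * |a - b| := by
    intro a b
    refine (hφmin a (φ b) (hφ b)).trans ?_
    have h2 := expect_le_of_le h.density h.cmax_nonneg ((hV a).tame 1 h1k) ((hV b).tame 1 h1k)
      (h.lipBound_nonneg h1k) (h.lipBound_nonneg h1k) (h.solution_le (hV a) (hV b) h1k)
      (0 + φ b)
    have h3 := mul_le_mul_of_nonneg_left h2 h.γ_nonneg
    simp only [hW, orderCost, contCost]
    linarith
  have hcontr : ContractingWith ⟨M.γ, h.γ_nonneg⟩ W := by
    refine ⟨NNReal.coe_lt_coe.1 h.γ_lt, LipschitzWith.of_dist_le_mul fun a b => ?_⟩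
    rw [Real.dist_eq, Real.dist_eq]
    change |W a - W b| ≤ M.γ * |a - b|
    have h1 := hle a b
    have h2 := hle b a
    rw [abs_sub_comm b a] at h2
    rw [abs_le]
    constructor <;> linarith
  set lam := hcontr.fixedPoint W
  have hfix : W lam = lam := hcontr.fixedPoint_isFixedPt
  refine ⟨lam, V lam, hV lam, ?_, ?_, φ lam, hφ lam, hfix.symm⟩
  · have hφ' : φ lam ∈ Set.Icc 0 (cmax - 0) := by simpa using hφ lam
    have h2 := le_expect_of_le h.density h.cmax_nonneg ((hV lam).tame 1 h1k)
      (h.lipBound_nonneg h1k) (h.min_le_solution (hV lam) h1k) (0 + φ lam)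
    have h3 := mul_le_mul_of_nonneg_left h2 h.γ_nonneg
    have h5 := h.stage_nonneg h1k h.zero_mem hφ'
    have h6 : M.γ * min lam 0 ≤ lam := by
      rw [← hfix]
      nth_rewrite 1 [hfix]
      simp only [hW, orderCost, contCost]
      linarith
    -- A negative `lam` would satisfy γ lam ≤ lam, which contradicts γ < 1.
    by_contra hcon
    rw [not_le] at hcon
    rw [min_eq_left hcon.le] at h6
    nlinarith [h.γ_lt]
  · intro u hu
    exact hfix.symm.le.trans (hφmin lam u hu)

end Setup

/-! ### The Bellman equation in terms of states and decisions. -/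

/-- Solutions of the backward recursion whose reset cost `lam` is the optimal cost from `(0, 0)`,
attained by the order `φ`. -/
structure IsFixedSolution (M : Problem) (f : ℝ → ℝ) (cmax c K : ℝ) (H : ℝ → ℕ → ℝ) (N : ℕ → ℝ)
    (lam : ℝ) (V : ℕ → ℝ → ℝ) (φ : ℝ) : Prop extends IsSolution M f cmax c K H N lam V where
  nonneg : 0 ≤ lam
  le : ∀ u ∈ Set.Icc 0 cmax, lam ≤ orderCost c K (contCost M f H (V 1) 0) 0 u
  φ_mem : φ ∈ Set.Icc 0 cmax
  eq : lam = orderCost c K (contCost M f H (V 1) 0) 0 φ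

/-- Cost-to-go as an extended nonnegative function of the state. -/
def stateValue (V : ℕ → ℝ → ℝ) (y : ℝ × ℕ) : ℝ≥0∞ := ENNReal.ofReal (V y.2 y.1)

/-- Cost of one period plus the discounted cost-to-go. -/
def stepCost (M : Problem) (V : ℕ → ℝ → ℝ) (q : ((ℝ × ℕ) × Bool × ℝ) × ℝ) : ℝ≥0∞ :=
  M.periodCost q.1.1 q.1.2.1 q.1.2.2 q.2 +
    ENNReal.ofReal M.γ * stateValue V (M.next q.1.1 q.1.2.1 q.1.2.2 q.2)

/-- Expected cost of a reset decision `r` followed by an order `u`. -/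
def decisionCost (M : Problem) (f : ℝ → ℝ) (c K : ℝ) (H : ℝ → ℕ → ℝ) (V : ℕ → ℝ → ℝ)
    (y : ℝ × ℕ) (r : Bool) (u : ℝ) : ℝ :=
  (if r then M.R f y.1 y.2 else 0) +
    orderCost c K (contCost M f H (V ((M.pseudo y r).2 + 1)) (M.pseudo y r).2) (M.pseudo y r).1 u

/-- Decisions after which the state satisfies all constraints. -/
def Feasible (M : Problem) (cmax : ℝ) (y : ℝ × ℕ) (r : Bool) (u : ℝ) : Prop :=
  (M.pseudo y r).2 < M.k ∧ u ∈ Set.Icc 0 (cmax - (M.pseudo y r).1)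

/-- A feedback policy that attains the minimum in the backward recursion. -/
def IsGreedy (M : Problem) (f : ℝ → ℝ) (cmax c K : ℝ) (H : ℝ → ℕ → ℝ) (V : ℕ → ℝ → ℝ)
    (π : ℝ → ℕ → Bool × ℝ) : Prop :=
  ∀ x ∈ Set.Icc 0 cmax, ∀ t ≤ M.k, Feasible M cmax (x, t) (π x t).1 (π x t).2 ∧
    V t x = decisionCost M f c K H V (x, t) (π x t).1 (π x t).2

namespace Setup

variable {M : Problem} {f : ℝ → ℝ} {cmax c K L B : ℝ} {H : ℝ → ℕ → ℝ} {κ m η : ℕ → ℝ}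
  {lam φ : ℝ} {V : ℕ → ℝ → ℝ}

theorem next_eq (h : Setup M f cmax c K L B H κ m η) (y : ℝ × ℕ) (r : Bool) (u d : ℝ) :
    M.next y r u d = (max ((M.pseudo y r).1 + u - d) 0, (M.pseudo y r).2 + 1) := by
  rw [Problem.next, h.dynamics]

theorem pseudo_mem (h : Setup M f cmax c K L B H κ m η) {y : ℝ × ℕ} (hy : y.1 ∈ Set.Icc 0 cmax)
    (r : Bool) : (M.pseudo y r).1 ∈ Set.Icc 0 cmax := by
  cases r
  · exact hy
  · simpa [Problem.pseudo, h.reset.zeta_eq] using h.cmax_nonneg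

theorem next_mem (h : Setup M f cmax c K L B H κ m η) {y : ℝ × ℕ} {r : Bool} {u d : ℝ}
    (hu : u ∈ Set.Icc 0 (cmax - (M.pseudo y r).1)) (hd : 0 ≤ d) :
    (M.next y r u d).1 ∈ Set.Icc 0 cmax := by
  rw [h.next_eq]
  exact ⟨le_max_right _ _, max_le (by linarith [hu.2]) h.cmax_nonneg⟩

theorem solution_nonneg (h : Setup M f cmax c K L B H κ m η)
    (hV : IsFixedSolution M f cmax c K H (lipBound M.k cmax c L B κ m η) lam V φ)
    {t : ℕ} (ht : t ≤ M.k) (x : ℝ) : 0 ≤ V t x := by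
  have := h.min_le_solution hV.toIsSolution ht _ (clamp_mem h.cmax_nonneg x)
  rwa [min_eq_right hV.nonneg, (hV.tame t ht).clamp_eq] at this

/-- A reset is followed by an order from (0,0), and the fixed-point property says that this order
costs at least `lam`. -/
theorem solution_le_decisionCost (h : Setup M f cmax c K L B H κ m η)
    (hV : IsFixedSolution M f cmax c K H (lipBound M.k cmax c L B κ m η) lam V φ)
    {x : ℝ} {t : ℕ} {r : Bool} {u : ℝ} (hx : x ∈ Set.Icc 0 cmax) (ht : t ≤ M.k)
    (hf : Feasible M cmax (x, t) r u) : V t x ≤ decisionCost M f c K H V (x, t) r u := by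
  cases r
  · simpa [decisionCost, Problem.pseudo] using hV.le_order t hf.1 x hx u hf.2
  · have h1 := hV.le_reset t ht x hx
    have h2 : u ∈ Set.Icc 0 cmax := by
      simpa [Problem.pseudo, h.reset.zeta_eq] using hf.2
    have h3 := hV.le u h2
    simp only [decisionCost, Problem.pseudo, if_true, h.reset.zeta_eq, zero_add]
    linarith

theorem decisionCost_reset (h : Setup M f cmax c K L B H κ m η)
    (hV : IsFixedSolution M f cmax c K H (lipBound M.k cmax c L B κ m η) lam V φ)
    (x : ℝ) (t : ℕ) : decisionCost M f c K H V (x, t) true φ = lam + M.R f x t := by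
  simp only [decisionCost, Problem.pseudo, if_true, h.reset.zeta_eq, zero_add]
  rw [← hV.eq, add_comm]

theorem feasible_reset (h : Setup M f cmax c K L B H κ m η)
    (hV : IsFixedSolution M f cmax c K H (lipBound M.k cmax c L B κ m η) lam V φ)
    (x : ℝ) (t : ℕ) : Feasible M cmax (x, t) true φ := by
  refine ⟨h.one_le, ?_⟩
  simpa [Problem.pseudo, h.reset.zeta_eq] using hV.φ_mem

/-- The bridge between path costs in [0, ∞] and the real recursion. Stage cost, reset cost and
continuation are each nonnegative, so `ENNReal.ofReal` respects their sum. -/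
theorem lintegral_stepCost (h : Setup M f cmax c K L B H κ m η)
    (hg : ∀ τ, Measurable fun p : ℝ × ℝ × ℝ => M.g p.1 τ p.2.1 p.2.2)
    (hV : IsFixedSolution M f cmax c K H (lipBound M.k cmax c L B κ m η) lam V φ)
    {x : ℝ} {t : ℕ} {r : Bool} {u : ℝ} (hx : x ∈ Set.Icc 0 cmax) (ht : t ≤ M.k)
    (hf : Feasible M cmax (x, t) r u) :
    ∫⁻ d, stepCost M V (((x, t), r, u), d) ∂demandLaw f =
      ENNReal.ofReal (decisionCost M f c K H V (x, t) r u) := by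
  have hprob := h.density.prob
  set ξ := (M.pseudo (x, t) r).1 with hξ
  set τ := (M.pseudo (x, t) r).2 with hτ
  have hτk : τ < M.k := hf.1
  have hξm : ξ ∈ Set.Icc 0 cmax := h.pseudo_mem hx r
  have hgm : Measurable fun d => (M.g ξ τ u d : ℝ≥0∞) :=
    ((hg τ).comp (measurable_const.prodMk (measurable_const.prodMk measurable_id))).coe_nnreal_ennreal
  have hgi : ∫⁻ d, (M.g ξ τ u d : ℝ≥0∞) ∂demandLaw f =
      ENNReal.ofReal (c * u + K * (if 0 < u then 1 else 0) + H (ξ + u) τ) := by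
    rw [← h.stage.expect_eq τ hτk ξ hξm u hf.2]
    exact lintegral_coe_eq_integral _ (h.stage.integrable τ hτk ξ hξm u hf.2)
  have hsi : ∫⁻ d, ((if r then M.s x t d else 0 : ℝ≥0) : ℝ≥0∞) ∂demandLaw f =
      ENNReal.ofReal (if r then M.R f x t else 0) := by
    cases r
    · simp
    · exact lintegral_coe_eq_integral _ (h.reset.integrable t ht x hx)
  have htame := hV.tame (τ + 1) hτk
  have hvi : ∫⁻ d, ENNReal.ofReal M.γ * ENNReal.ofReal (V (τ + 1) (max (ξ + u - d) 0)) ∂demandLaw f =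
      ENNReal.ofReal (M.γ * expect f (V (τ + 1)) (ξ + u)) := by
    have hm : Measurable fun d => V (τ + 1) (max (ξ + u - d) 0) :=
      (hV.measurable _).comp (by fun_prop)
    rw [lintegral_const_mul _ hm.ennreal_ofReal, ENNReal.ofReal_mul h.γ_nonneg, expect,
      ofReal_integral_eq_lintegral_ofReal
        (htame.integrable h.cmax_nonneg (h.lipBound_nonneg hτk) _ _)
        (Filter.Eventually.of_forall fun d => h.solution_nonneg hV hτk _)]
    simp only [htame.max_zero_eq]
  have hm' : Measurable fun d => ENNReal.ofReal M.γ *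
      ENNReal.ofReal (V (τ + 1) (max (ξ + u - d) 0)) :=
    (((hV.measurable _).comp (by fun_prop)).ennreal_ofReal).const_mul _
  have hexp : 0 ≤ M.γ * expect f (V (τ + 1)) (ξ + u) :=
    mul_nonneg h.γ_nonneg (integral_nonneg fun _ => h.solution_nonneg hV hτk _)
  have hstage := h.stage_nonneg hτk hξm hf.2
  have hR : 0 ≤ if r then M.R f x t else 0 := by
    split_ifs
    · exact R_nonneg _ _ _ _
    · exact le_rfl
  simp only [stepCost, Problem.periodCost, stateValue, h.next_eq, ← hξ, ← hτ, ENNReal.coe_add]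
  rw [lintegral_add_right _ hm', lintegral_add_left hgm, hgi, hsi, hvi,
    ← ENNReal.ofReal_add hstage hR, ← ENNReal.ofReal_add (add_nonneg hstage hR) hexp]
  congr 1
  simp only [decisionCost, orderCost, contCost, ← hξ, ← hτ]
  ring

theorem exists_bound
    (hV : IsFixedSolution M f cmax c K H (lipBound M.k cmax c L B κ m η) lam V φ)
    (h : Setup M f cmax c K L B H κ m η) :
    ∃ C : ℝ, ∀ t ≤ M.k, ∀ x, V t x ≤ C := by
  refine ⟨∑ t ∈ Finset.range (M.k + 1), (|V t 0| + |lipBound M.k cmax c L B κ m η t * cmax|),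
    fun t ht x => ?_⟩
  have h1 := (le_abs_self _).trans
    ((hV.tame t ht).abs_sub_zero_le h.cmax_nonneg (h.lipBound_nonneg ht) x)
  have h2 := Finset.single_le_sum
    (f := fun t => |V t 0| + |lipBound M.k cmax c L B κ m η t * cmax|)
    (fun i _ => by positivity) (Finset.mem_range.2 (Nat.lt_succ_of_le ht))
  refine le_trans ?_ h2
  have h3 := le_abs_self (V t 0)
  have h4 := le_abs_self (lipBound M.k cmax c L B κ m η t * cmax)
  linarith

theorem measurable_pseudo {α : Type*} {mα : MeasurableSpace α} {Y : α → ℝ × ℕ} {r : α → Bool}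
    (hY : Measurable Y) (hr : Measurable r) : Measurable fun a => M.pseudo (Y a) (r a) :=
  Measurable.ite (hr (measurableSet_singleton true)) measurable_const hY

theorem measurable_next (h : Setup M f cmax c K L B H κ m η) {α : Type*} {mα : MeasurableSpace α}
    {Y : α → ℝ × ℕ} {r : α → Bool} {u d : α → ℝ}
    (hY : Measurable Y) (hr : Measurable r) (hu : Measurable u) (hd : Measurable d) :
    Measurable fun a => M.next (Y a) (r a) (u a) (d a) := by
  simp only [h.next_eq]
  have hp : Measurable fun a => M.pseudo (Y a) (r a) := measurable_pseudo hY hr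
  exact (((hp.fst.add hu).sub hd).max measurable_const).prodMk
    ((measurable_from_top (f := fun n : ℕ => n + 1)).comp hp.snd)

theorem measurable_periodCost
    (hg : ∀ τ, Measurable fun p : ℝ × ℝ × ℝ => M.g p.1 τ p.2.1 p.2.2)
    (hs : ∀ t, Measurable fun p : ℝ × ℝ => M.s p.1 t p.2)
    {α : Type*} {mα : MeasurableSpace α} {Y : α → ℝ × ℕ} {r : α → Bool} {u d : α → ℝ}
    (hY : Measurable Y) (hr : Measurable r) (hu : Measurable u) (hd : Measurable d) :
    Measurable fun a => M.periodCost (Y a) (r a) (u a) (d a) := by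
  have hg' : Measurable fun p : (ℝ × ℝ × ℝ) × ℕ => M.g p.1.1 p.2 p.1.2.1 p.1.2.2 :=
    measurable_from_prod_countable_left hg
  have hs' : Measurable fun p : (ℝ × ℝ) × ℕ => M.s p.1.1 p.2 p.1.2 :=
    measurable_from_prod_countable_left hs
  have hp : Measurable fun a => M.pseudo (Y a) (r a) := measurable_pseudo hY hr
  exact (hg'.comp ((hp.fst.prodMk (hu.prodMk hd)).prodMk hp.snd)).add
    (Measurable.ite (hr (measurableSet_singleton true))
      (hs'.comp ((hY.fst.prodMk hd).prodMk hY.snd)) measurable_const)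

theorem measurable_stateValue
    (hV : IsFixedSolution M f cmax c K H (lipBound M.k cmax c L B κ m η) lam V φ) :
    Measurable (stateValue V) :=
  (measurable_from_prod_countable_left (f := fun y : ℝ × ℕ => V y.2 y.1)
    hV.measurable).ennreal_ofReal

theorem measurable_stepCost (h : Setup M f cmax c K L B H κ m η)
    (hg : ∀ τ, Measurable fun p : ℝ × ℝ × ℝ => M.g p.1 τ p.2.1 p.2.2)
    (hs : ∀ t, Measurable fun p : ℝ × ℝ => M.s p.1 t p.2)
    (hV : IsFixedSolution M f cmax c K H (lipBound M.k cmax c L B κ m η) lam V φ) :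
    Measurable (stepCost M V) := by
  have h1 : Measurable fun q : ((ℝ × ℕ) × Bool × ℝ) × ℝ => q.1.1 := by fun_prop
  have h2 : Measurable fun q : ((ℝ × ℕ) × Bool × ℝ) × ℝ => q.1.2.1 := by fun_prop
  have h3 : Measurable fun q : ((ℝ × ℕ) × Bool × ℝ) × ℝ => q.1.2.2 := by fun_prop
  exact (measurable_periodCost hg hs h1 h2 h3 measurable_snd).coe_nnreal_ennreal.add
    (((measurable_stateValue hV).comp (h.measurable_next h1 h2 h3 measurable_snd)).const_mul _)

end Setup

/-! ### Verification along random trajectories. -/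

section Verification

variable {Ω : Type*} {mΩ : MeasurableSpace Ω} {Pr : Measure Ω}
  {ℱ : Filtration ℕ mΩ} {w : ℕ → Ω → ℝ}
  {M : Problem} {f : ℝ → ℝ} {cmax c K L B : ℝ} {H : ℝ → ℕ → ℝ} {κ m η : ℕ → ℝ}
  {lam φ : ℝ} {V : ℕ → ℝ → ℝ}

/-- The random state at time `n`. -/
def stateAt (M : Problem) (w : ℕ → Ω → ℝ) (y₀ : ℝ × ℕ) (a : Control Ω) (n : ℕ) (ω : Ω) : ℝ × ℕ :=
  M.state y₀ (fun j => w j ω) (fun j => a.r j ω) (fun j => a.u j ω) n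

theorem stateAt_succ (M : Problem) (w : ℕ → Ω → ℝ) (y₀ : ℝ × ℕ) (a : Control Ω) (n : ℕ) (ω : Ω) :
    stateAt M w y₀ a (n + 1) ω =
      M.next (stateAt M w y₀ a n ω) (a.r n ω) (a.u n ω) (w n ω) := rfl

theorem measurable_stateAt (h : Setup M f cmax c K L B H κ m η) (hinfo : Information Pr ℱ w)
    {a : Control Ω} (hr : ∀ n, Measurable[ℱ n] (a.r n)) (hu : ∀ n, Measurable[ℱ n] (a.u n))
    (y₀ : ℝ × ℕ) (n : ℕ) : Measurable[ℱ n] (stateAt M w y₀ a n) := by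
  induction n with
  | zero => exact measurable_const
  | succ n ih =>
    have hle := ℱ.mono (Nat.le_succ n)
    exact h.measurable_next (mα := ℱ (n + 1)) (ih.mono hle le_rfl) ((hr n).mono hle le_rfl)
      ((hu n).mono hle le_rfl) (hinfo.past n)

/-- Integration against a demand that is independent of the past. -/
theorem lintegral_indep_demand [IsProbabilityMeasure Pr] {α : Type*} {mα : MeasurableSpace α} (hinfo : Information Pr ℱ w)
    {n : ℕ} (hw : Measurable (w n)) (hlaw : Pr.map (w n) = demandLaw f)
    {X : Ω → α} (hX : Measurable[ℱ n] X) {F : α × ℝ → ℝ≥0∞} (hF : Measurable F) :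
    ∫⁻ ω, F (X ω, w n ω) ∂Pr = ∫⁻ ω, ∫⁻ d, F (X ω, d) ∂demandLaw f ∂Pr := by
  have hX' : Measurable X := hX.mono (ℱ.le n) le_rfl
  have hind : IndepFun X (w n) Pr := by
    rw [IndepFun_iff_Indep]
    exact indep_of_indep_of_le_left (hinfo.indep n).symm hX.comap_le
  have hprob : IsProbabilityMeasure (demandLaw f) :=
    hlaw ▸ Measure.isProbabilityMeasure_map hw.aemeasurable
  rw [← lintegral_map (f := F) (g := fun ω => (X ω, w n ω)) hF (hX'.prodMk hw),
    (indepFun_iff_map_prod_eq_prod_map_map hX'.aemeasurable hw.aemeasurable).1 hind, hlaw,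
    lintegral_prod _ hF.aemeasurable, lintegral_map hF.lintegral_prod_right' hX']

theorem state_mem (h : Setup M f cmax c K L B H κ m η) {y₀ : ℝ × ℕ} (hy₀ : y₀.1 ∈ Set.Icc 0 cmax)
    {d : ℕ → ℝ} {r : ℕ → Bool} {u : ℕ → ℝ} (hd : ∀ n, 0 ≤ d n)
    (hu : ∀ n, u n ∈ Set.Icc 0 (cmax - (M.pseudo (M.state y₀ d r u n) (r n)).1)) (n : ℕ) :
    (M.state y₀ d r u n).1 ∈ Set.Icc 0 cmax := by
  cases n with
  | zero => exact hy₀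
  | succ n => exact h.next_mem (hu n) (hd n)

/-- Almost surely, the state stays in the domain and the decisions are feasible. -/
def StaysFeasible (Pr : Measure Ω) (w : ℕ → Ω → ℝ) (M : Problem) (cmax : ℝ) (y₀ : ℝ × ℕ)
    (a : Control Ω) : Prop :=
  ∀ᵐ ω ∂Pr, ∀ n, (stateAt M w y₀ a n ω).1 ∈ Set.Icc 0 cmax ∧ (stateAt M w y₀ a n ω).2 ≤ M.k ∧
    Feasible M cmax (stateAt M w y₀ a n ω) (a.r n ω) (a.u n ω)

theorem ae_demand_nonneg (h5 : A5 Pr w f L B) (hd : DemandDensity f L B) :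
    ∀ᵐ ω ∂Pr, ∀ n, 0 ≤ w n ω := by
  rw [ae_all_iff]
  intro n
  have := hd.ae_nonneg
  rw [← h5.law n] at this
  exact ae_of_ae_map (h5.measurable n).aemeasurable this

theorem staysFeasible_of_admissible (h : Setup M f cmax c K L B H κ m η) (h5 : A5 Pr w f L B)
    {y₀ : ℝ × ℕ} (hy₀ : y₀.1 ∈ Set.Icc 0 cmax) {a : Control Ω}
    (ha : M.Admissible Pr ℱ w y₀ a) : StaysFeasible Pr w M cmax y₀ a := by
  filter_upwards [ha.time_le, ha.input_mem, ae_demand_nonneg h5 h.density] with ω h1 h2 h3 n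
  have hu : ∀ n, a.u n ω ∈ Set.Icc 0 (cmax - (M.pseudo (stateAt M w y₀ a n ω) (a.r n ω)).1) := by
    intro n
    have := h2 n _ rfl
    rw [h.input.2] at this
    exact this
  refine ⟨state_mem h hy₀ h3 hu n, h1 n, ?_, hu n⟩
  -- The time constraint one period later is what forces a pseudo-time strictly below k now.
  have := h1 (n + 1)
  change (M.next (stateAt M w y₀ a n ω) (a.r n ω) (a.u n ω) (w n ω)).2 ≤ M.k at this
  rw [h.next_eq] at this
  exact this

/-- Expected cost of period `n`. -/
def periodMean (Pr : Measure Ω) (w : ℕ → Ω → ℝ) (M : Problem) (y₀ : ℝ × ℕ) (a : Control Ω)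
    (n : ℕ) : ℝ≥0∞ :=
  ∫⁻ ω, M.periodCost (stateAt M w y₀ a n ω) (a.r n ω) (a.u n ω) (w n ω) ∂Pr

/-- Expected cost-to-go at time `n`. -/
def valueMean (Pr : Measure Ω) (w : ℕ → Ω → ℝ) (M : Problem) (V : ℕ → ℝ → ℝ) (y₀ : ℝ × ℕ)
    (a : Control Ω) (n : ℕ) : ℝ≥0∞ :=
  ∫⁻ ω, stateValue V (stateAt M w y₀ a n ω) ∂Pr

theorem measurable_periodCost_stateAt (h : Setup M f cmax c K L B H κ m η)
    (hg : ∀ τ, Measurable fun p : ℝ × ℝ × ℝ => M.g p.1 τ p.2.1 p.2.2)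
    (hs : ∀ t, Measurable fun p : ℝ × ℝ => M.s p.1 t p.2) (hinfo : Information Pr ℱ w)
    (h5 : A5 Pr w f L B) {a : Control Ω} (hr : ∀ n, Measurable[ℱ n] (a.r n))
    (hu : ∀ n, Measurable[ℱ n] (a.u n)) (y₀ : ℝ × ℕ) (n : ℕ) :
    Measurable fun ω => (M.periodCost (stateAt M w y₀ a n ω) (a.r n ω) (a.u n ω) (w n ω) : ℝ≥0∞) :=
  (Setup.measurable_periodCost hg hs
    ((measurable_stateAt h hinfo hr hu y₀ n).mono (ℱ.le n) le_rfl)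
    ((hr n).mono (ℱ.le n) le_rfl) ((hu n).mono (ℱ.le n) le_rfl)
    (h5.measurable n)).coe_nnreal_ennreal

theorem cost_eq_tsum (h : Setup M f cmax c K L B H κ m η)
    (hg : ∀ τ, Measurable fun p : ℝ × ℝ × ℝ => M.g p.1 τ p.2.1 p.2.2)
    (hs : ∀ t, Measurable fun p : ℝ × ℝ => M.s p.1 t p.2) (hinfo : Information Pr ℱ w)
    (h5 : A5 Pr w f L B) {a : Control Ω} (hr : ∀ n, Measurable[ℱ n] (a.r n))
    (hu : ∀ n, Measurable[ℱ n] (a.u n)) (y₀ : ℝ × ℕ) :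
    M.cost Pr w y₀ a = ∑' n, ENNReal.ofReal M.γ ^ n * periodMean Pr w M y₀ a n := by
  have hm := measurable_periodCost_stateAt h hg hs hinfo h5 hr hu y₀
  unfold Problem.cost Problem.pathCost
  refine (lintegral_tsum fun n => ((hm n).const_mul _).aemeasurable).trans ?_
  exact tsum_congr fun n => lintegral_const_mul _ (hm n)

/-- State and decisions at time n are measurable with respect to the past, and the current demand is
independent of it. Fubini then allows the demand to be integrated first, at a fixed feasible
decision. -/
theorem periodMean_add_valueMean [IsProbabilityMeasure Pr] (h : Setup M f cmax c K L B H κ m η)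
    (hg : ∀ τ, Measurable fun p : ℝ × ℝ × ℝ => M.g p.1 τ p.2.1 p.2.2)
    (hs : ∀ t, Measurable fun p : ℝ × ℝ => M.s p.1 t p.2) (hinfo : Information Pr ℱ w)
    (h5 : A5 Pr w f L B)
    (hV : IsFixedSolution M f cmax c K H (lipBound M.k cmax c L B κ m η) lam V φ)
    {a : Control Ω} (hr : ∀ n, Measurable[ℱ n] (a.r n)) (hu : ∀ n, Measurable[ℱ n] (a.u n))
    {y₀ : ℝ × ℕ} (hfeas : StaysFeasible Pr w M cmax y₀ a) (n : ℕ) :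
    periodMean Pr w M y₀ a n + ENNReal.ofReal M.γ * valueMean Pr w M V y₀ a (n + 1) =
      ∫⁻ ω, ENNReal.ofReal (decisionCost M f c K H V (stateAt M w y₀ a n ω) (a.r n ω) (a.u n ω))
        ∂Pr := by
  have hY := measurable_stateAt h hinfo hr hu y₀
  have hval : Measurable fun ω => stateValue V (stateAt M w y₀ a (n + 1) ω) :=
    (Setup.measurable_stateValue hV).comp ((hY (n + 1)).mono (ℱ.le _) le_rfl)
  rw [periodMean, valueMean, ← lintegral_const_mul _ hval,
    ← lintegral_add_left (measurable_periodCost_stateAt h hg hs hinfo h5 hr hu y₀ n)]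
  have hX : Measurable[ℱ n] fun ω => (stateAt M w y₀ a n ω, a.r n ω, a.u n ω) :=
    (hY n).prodMk ((hr n).prodMk (hu n))
  refine (lintegral_indep_demand hinfo (h5.measurable n) (h5.law n) hX
    (h.measurable_stepCost hg hs hV)).trans ?_
  refine lintegral_congr_ae ?_
  filter_upwards [hfeas] with ω hω
  obtain ⟨h1, h2, h3⟩ := hω n
  exact h.lintegral_stepCost hg hV h1 h2 h3

theorem valueMean_zero (Pr : Measure Ω) [IsProbabilityMeasure Pr] (w : ℕ → Ω → ℝ) (M : Problem)
    (V : ℕ → ℝ → ℝ) (y₀ : ℝ × ℕ) (a : Control Ω) :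
    valueMean Pr w M V y₀ a 0 = stateValue V y₀ := by
  simp [valueMean, stateAt, Problem.state]

theorem le_sum_of_le_add {v p : ℕ → ℝ≥0∞} {q : ℝ≥0∞} (h : ∀ n, v n ≤ p n + q * v (n + 1))
    (n : ℕ) : v 0 ≤ ∑ i ∈ Finset.range n, q ^ i * p i + q ^ n * v n := by
  induction n with
  | zero => simp
  | succ n ih =>
    refine ih.trans ?_
    rw [Finset.sum_range_succ, add_assoc]
    gcongr
    refine (mul_le_mul_right (h n) _).trans_eq ?_
    rw [mul_add, pow_succ, mul_assoc]

theorem sum_le_of_eq_add {v p : ℕ → ℝ≥0∞} {q : ℝ≥0∞} (h : ∀ n, p n + q * v (n + 1) = v n)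
    (n : ℕ) : ∑ i ∈ Finset.range n, q ^ i * p i + q ^ n * v n = v 0 := by
  induction n with
  | zero => simp
  | succ n ih =>
    rw [← ih, Finset.sum_range_succ, add_assoc, ← h n, mul_add, pow_succ, mul_assoc]

/-- No admissible control costs less than the solution of the backward recursion. -/
theorem stateValue_le_cost [IsProbabilityMeasure Pr] (h : Setup M f cmax c K L B H κ m η)
    (hg : ∀ τ, Measurable fun p : ℝ × ℝ × ℝ => M.g p.1 τ p.2.1 p.2.2)
    (hs : ∀ t, Measurable fun p : ℝ × ℝ => M.s p.1 t p.2) (hinfo : Information Pr ℱ w)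
    (h5 : A5 Pr w f L B)
    (hV : IsFixedSolution M f cmax c K H (lipBound M.k cmax c L B κ m η) lam V φ)
    {y₀ : ℝ × ℕ} (hy₀ : y₀.1 ∈ Set.Icc 0 cmax) {a : Control Ω}
    (ha : M.Admissible Pr ℱ w y₀ a) : stateValue V y₀ ≤ M.cost Pr w y₀ a := by
  have hfeas := staysFeasible_of_admissible h h5 hy₀ ha
  have hstep : ∀ n, valueMean Pr w M V y₀ a n ≤
      periodMean Pr w M y₀ a n + ENNReal.ofReal M.γ * valueMean Pr w M V y₀ a (n + 1) := by
    intro n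
    rw [periodMean_add_valueMean h hg hs hinfo h5 hV ha.adapted_r ha.adapted_u hfeas]
    refine lintegral_mono_ae ?_
    filter_upwards [hfeas] with ω hω
    obtain ⟨h1, h2, h3⟩ := hω n
    exact ENNReal.ofReal_le_ofReal (h.solution_le_decisionCost hV h1 h2 h3)
  obtain ⟨C, hC⟩ := Setup.exists_bound hV h
  have hbound : ∀ n, valueMean Pr w M V y₀ a n ≤ ENNReal.ofReal C := by
    intro n
    have : valueMean Pr w M V y₀ a n ≤ ∫⁻ _, ENNReal.ofReal C ∂Pr := by
      refine lintegral_mono_ae ?_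
      filter_upwards [hfeas] with ω hω
      exact ENNReal.ofReal_le_ofReal (hC _ (hω n).2.1 _)
    simpa using this
  rw [cost_eq_tsum h hg hs hinfo h5 ha.adapted_r ha.adapted_u, ← valueMean_zero Pr w M V y₀ a]
  have hγ : ENNReal.ofReal M.γ < 1 := by
    rw [← ENNReal.ofReal_one]
    exact (ENNReal.ofReal_lt_ofReal_iff one_pos).2 h.γ_lt
  set T := ∑' n, ENNReal.ofReal M.γ ^ n * periodMean Pr w M y₀ a n
  -- The remainder vanishes because the value functions are bounded above and γ < 1.
  have hlim : Filter.Tendsto (fun n => T + ENNReal.ofReal M.γ ^ n * ENNReal.ofReal C)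
      Filter.atTop (nhds (T + 0 * ENNReal.ofReal C)) :=
    tendsto_const_nhds.add (ENNReal.Tendsto.mul_const
      (ENNReal.tendsto_pow_atTop_nhds_zero_of_lt_one hγ) (Or.inr ENNReal.ofReal_ne_top))
  rw [zero_mul, add_zero] at hlim
  refine ge_of_tendsto' hlim fun n => (le_sum_of_le_add hstep n).trans ?_
  gcongr
  · exact ENNReal.sum_le_tsum _
  · exact hbound n

theorem stateAt_feedback (M : Problem) (w : ℕ → Ω → ℝ) (π : ℝ → ℕ → Bool × ℝ) (y₀ : ℝ × ℕ) (n : ℕ)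
    (ω : Ω) : stateAt M w y₀ (M.feedback w π y₀) n ω = M.loopState π y₀ (fun j => w j ω) n := by
  induction n with
  | zero => rfl
  | succ n ih =>
    rw [stateAt_succ, ih]
    rfl

theorem measurable_loopState (h : Setup M f cmax c K L B H κ m η) (hinfo : Information Pr ℱ w)
    {π : ℝ → ℕ → Bool × ℝ} (hπ : ∀ t, Measurable fun x => π x t) (y₀ : ℝ × ℕ) (n : ℕ) :
    Measurable[ℱ n] fun ω => M.loopState π y₀ (fun j => w j ω) n := by
  have hπ' : Measurable fun y : ℝ × ℕ => π y.1 y.2 := measurable_from_prod_countable_left hπ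
  induction n with
  | zero => exact measurable_const
  | succ n ih =>
    have ih' := ih.mono (ℱ.mono (Nat.le_succ n)) le_rfl
    exact h.measurable_next (mα := ℱ (n + 1)) ih' (hπ'.comp ih').fst (hπ'.comp ih').snd
      (hinfo.past n)

theorem admissible_feedback (h : Setup M f cmax c K L B H κ m η) (hinfo : Information Pr ℱ w)
    (h5 : A5 Pr w f L B) {π : ℝ → ℕ → Bool × ℝ} (hπ : ∀ t, Measurable fun x => π x t)
    (hgreedy : ∀ x ∈ Set.Icc 0 cmax, ∀ t ≤ M.k, Feasible M cmax (x, t) (π x t).1 (π x t).2)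
    {y₀ : ℝ × ℕ} (hy₀ : y₀.1 ∈ Set.Icc 0 cmax) (ht₀ : y₀.2 ≤ M.k) :
    M.Admissible Pr ℱ w y₀ (M.feedback w π y₀) := by
  have hπ' : Measurable fun y : ℝ × ℕ => π y.1 y.2 := measurable_from_prod_countable_left hπ
  have hloop : ∀ᵐ ω ∂Pr, ∀ n, (M.loopState π y₀ (fun j => w j ω) n).1 ∈ Set.Icc 0 cmax ∧
      (M.loopState π y₀ (fun j => w j ω) n).2 ≤ M.k := by
    filter_upwards [ae_demand_nonneg h5 h.density] with ω hω n
    induction n with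
    | zero => exact ⟨hy₀, ht₀⟩
    | succ n ih =>
      obtain ⟨h1, h2⟩ := hgreedy _ ih.1 _ ih.2
      refine ⟨h.next_mem h2 (hω n), ?_⟩
      rw [Problem.loopState, h.next_eq]
      exact h1
  refine ⟨fun n => ((hπ'.comp (measurable_loopState h hinfo hπ y₀ n))).fst,
    fun n => ((hπ'.comp (measurable_loopState h hinfo hπ y₀ n))).snd, ?_, ?_⟩
  · filter_upwards [hloop] with ω hω n
    have := (hω n).2
    rwa [← stateAt_feedback] at this
  · filter_upwards [hloop] with ω hω n y hy
    have hs := stateAt_feedback M w π y₀ n ω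
    rw [stateAt] at hs
    rw [hs] at hy
    rw [h.input.2, hy]
    exact (hgreedy _ (hω n).1 _ (hω n).2).2

/-- Greedy feedback policies attain the solution of the backward recursion. -/
theorem cost_feedback_le [IsProbabilityMeasure Pr] (h : Setup M f cmax c K L B H κ m η)
    (hg : ∀ τ, Measurable fun p : ℝ × ℝ × ℝ => M.g p.1 τ p.2.1 p.2.2)
    (hs : ∀ t, Measurable fun p : ℝ × ℝ => M.s p.1 t p.2) (hinfo : Information Pr ℱ w)
    (h5 : A5 Pr w f L B)
    (hV : IsFixedSolution M f cmax c K H (lipBound M.k cmax c L B κ m η) lam V φ)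
    {π : ℝ → ℕ → Bool × ℝ} (hπ : ∀ t, Measurable fun x => π x t)
    (hgreedy : IsGreedy M f cmax c K H V π)
    {y₀ : ℝ × ℕ} (hy₀ : y₀.1 ∈ Set.Icc 0 cmax) (ht₀ : y₀.2 ≤ M.k) :
    M.cost Pr w y₀ (M.feedback w π y₀) ≤ stateValue V y₀ := by
  have ha := admissible_feedback h hinfo h5 hπ (fun x hx t ht => (hgreedy x hx t ht).1) hy₀ ht₀
  have hfeas := staysFeasible_of_admissible h h5 hy₀ ha
  have hstep : ∀ n, periodMean Pr w M y₀ (M.feedback w π y₀) n +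
      ENNReal.ofReal M.γ * valueMean Pr w M V y₀ (M.feedback w π y₀) (n + 1) =
        valueMean Pr w M V y₀ (M.feedback w π y₀) n := by
    intro n
    rw [periodMean_add_valueMean h hg hs hinfo h5 hV ha.adapted_r ha.adapted_u hfeas]
    refine lintegral_congr_ae ?_
    filter_upwards [hfeas] with ω hω
    obtain ⟨h1, h2, -⟩ := hω n
    have := (hgreedy _ h1 _ h2).2
    rw [stateValue, this, stateAt_feedback]
    rfl
  rw [cost_eq_tsum h hg hs hinfo h5 ha.adapted_r ha.adapted_u,
    ← valueMean_zero Pr w M V y₀ (M.feedback w π y₀)]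
  -- No limit of the remainder is needed in this direction: it is nonnegative and can be dropped.
  refine ENNReal.tsum_le_of_sum_range_le fun n => ?_
  rw [← sum_le_of_eq_add hstep n]
  exact le_self_add

end Verification

/-! ### From the hypotheses to the recursion, and from the recursion to J. -/

section Value

variable {Ω : Type*} {mΩ : MeasurableSpace Ω} {Pr : Measure Ω}
  {ℱ : Filtration ℕ mΩ} {w : ℕ → Ω → ℝ}
  {M : Problem} {f : ℝ → ℝ} {cmax c K L B : ℝ} {H : ℝ → ℕ → ℝ} {κ m η : ℕ → ℝ}
  {lam φ : ℝ} {V : ℕ → ℝ → ℝ}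

theorem A5.demandDensity [IsProbabilityMeasure Pr] (h5 : A5 Pr w f L B) : DemandDensity f L B where
  prob := h5.law 0 ▸ Measure.isProbabilityMeasure_map (h5.measurable 0).aemeasurable
  nonneg := h5.f_nonneg
  neg := h5.f_neg
  L_nonneg := h5.L_nonneg
  lip := h5.f_lip
  bdd := h5.f_bdd

/-- Multiplying out is legitimate for every real d: if d ≤ 0, the quotient in [0, ∞] imposes no
useful bound, but the product is nonpositive. -/
theorem mul_le_of_ofReal_le_div {γ a d : ℝ} (hγ : 0 ≤ γ) (ha : 0 ≤ a)
    (h : ENNReal.ofReal γ ≤ ENNReal.ofReal a / ENNReal.ofReal d) : γ * d ≤ a := by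
  have := ENNReal.mul_le_of_le_div h
  rwa [← ENNReal.ofReal_mul hγ, ENNReal.ofReal_le_ofReal_iff ha] at this

theorem Setup.of_assumptions [IsProbabilityMeasure Pr] (hk : 1 ≤ M.k) (hγ0 : 0 ≤ M.γ) (hγ1 : M.γ < 1) (h1 : A1 M)
    (h2 : A2 M f cmax c K H κ m) (h3 : A3 M f cmax η) (h4 : A4 M cmax) (h5 : A5 Pr w f L B)
    (hγ : ∀ t < M.k, ENNReal.ofReal M.γ ≤ gammaBound M.k cmax c L B κ m η t) :
    Setup M f cmax c K L B H κ m η := by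
  refine ⟨hk, hγ0, hγ1, h1, h2, h3, h4, h5.demandDensity, fun t ht => ?_⟩
  have hpos : 0 < L * cmax + B :=
    add_pos_of_nonneg_of_pos (mul_nonneg h5.L_nonneg h4.1) h5.demandDensity.bound_pos
  have hm := (h2.m_pos t ht).le
  have hbd := hγ t ht
  unfold gammaBound at hbd
  unfold lipBound
  split_ifs at hbd ⊢ with h
  · rw [← h] at hbd
    exact mul_le_of_ofReal_le_div hγ0 hm hbd
  -- The denominator of γ_t is (L cmax + B) N_{t+1}; the summand m_{t+1} comes from the last term of
  -- N_{t+1}.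
  · rw [mul_add, mul_div_cancel₀ _ hpos.ne']
    exact mul_le_of_ofReal_le_div hγ0 hm hbd

theorem measurable_thresholdPolicy (k : ℕ) (σ s : ℕ → EReal) (S : ℕ → ℝ) (Sig : ℕ → EReal)
    (φ : ℝ) (t : ℕ) : Measurable fun x => thresholdPolicy k σ s S Sig φ x t := by
  have hlt : ∀ a : EReal, MeasurableSet {x : ℝ | (x : EReal) < a} := fun a =>
    measurableSet_lt measurable_coe_real_ereal measurable_const
  unfold thresholdPolicy
  split_ifs
  · exact Measurable.ite (hlt _) measurable_const (Measurable.ite (hlt _)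
      (measurable_const.prodMk (measurable_const.sub measurable_id))
      (Measurable.ite (hlt _) measurable_const measurable_const))
  · exact measurable_const

theorem isGreedy_thresholdPolicy (h : Setup M f cmax c K L B H κ m η)
    (hV : IsFixedSolution M f cmax c K H (lipBound M.k cmax c L B κ m η) lam V φ)
    {σ s : ℕ → EReal} {S : ℕ → ℝ} {Sig : ℕ → EReal}
    (hT : ∀ t < M.k, ThresholdForm cmax c K lam (fun x => M.R f x t)
      (contCost M f H (V (t + 1)) t) (V t) (S t) (σ t) (s t) (Sig t)) :
    IsGreedy M f cmax c K H V (thresholdPolicy M.k σ s S Sig φ) := by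
  intro x hx t ht
  have hreset : ∀ {v : ℝ}, v = lam + M.R f x t → Feasible M cmax (x, t) true φ ∧
      v = decisionCost M f c K H V (x, t) true φ := fun hv =>
    ⟨h.feasible_reset hV x t, by rw [hv, h.decisionCost_reset hV]⟩
  unfold thresholdPolicy
  split_ifs with h0 h1 h2 h3
  · exact hreset ((hT t h0).low x hx h1)
  · obtain ⟨h4, h5⟩ := (hT t h0).order x hx (not_lt.1 h1) h2
    refine ⟨⟨h0, ?_⟩, ?_⟩
    · exact ⟨by linarith, by simpa [Problem.pseudo] using (hT t h0).S_mem.2⟩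
    · simp [h5, decisionCost, orderCost, Problem.pseudo, h4]
  · refine ⟨⟨h0, le_rfl, ?_⟩, ?_⟩
    · simpa [Problem.pseudo] using hx.2
    · simp [(hT t h0).idle x hx (not_lt.1 h2) h3, decisionCost, orderCost, Problem.pseudo]
  · exact hreset ((hT t h0).high x hx (not_lt.1 h3))
  · obtain rfl : t = M.k := le_antisymm ht (not_lt.1 h0)
    exact hreset (hV.terminal x hx)

/-- A reset at (0,0) leads to the same pseudo-state and costs R(0,0) ≥ 0 on top, so it cannot
improve on `lam`. -/
theorem solution_zero (h : Setup M f cmax c K L B H κ m η)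
    (hV : IsFixedSolution M f cmax c K H (lipBound M.k cmax c L B κ m η) lam V φ) :
    V 0 0 = lam := by
  have h0 : (0 : ℝ) ∈ Set.Icc 0 cmax := h.zero_mem
  refine le_antisymm ?_ ?_
  · rw [hV.eq]
    exact hV.le_order 0 h.one_le 0 h0 φ (by simpa using hV.φ_mem)
  · obtain ⟨S, σ, s, Sig, hT⟩ := hV.threshold 0 h.one_le
    rcases hT.attained h0 with h1 | ⟨u, hu, h1⟩
    · linarith [Setup.R_nonneg M f 0 0]
    · rw [h1]
      exact hV.le u (by simpa using hu)

/-- J is identified with V only on [0, cmax]; nonnegative demand keeps the next level there almost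
surely. -/
theorem ae_J_eq (hJ : ∀ x ∈ Set.Icc 0 cmax, ∀ t ≤ M.k, M.J Pr ℱ w x t = V t x)
    (h : Setup M f cmax c K L B H κ m η)
    (hV : IsFixedSolution M f cmax c K H (lipBound M.k cmax c L B κ m η) lam V φ)
    {t : ℕ} (ht : t ≤ M.k) {z : ℝ} (hz : z ∈ Set.Icc 0 cmax) :
    (fun y => M.J Pr ℱ w (max (z - y) 0) t) =ᵐ[demandLaw f] fun y => V t (z - y) := by
  filter_upwards [h.density.ae_nonneg] with y hy
  rw [hJ _ ⟨le_max_right _ _, max_le (by linarith [hz.2]) h.cmax_nonneg⟩ t ht,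
    (hV.tame t ht).max_zero_eq]

end Value

/-! ### Derivatives of the pieces, and the theorem. -/

theorem LipschitzDerivOn.of_eq_add {cmax a : ℝ} {F φ p p' : ℝ → ℝ}
    (hφ : LipschitzDerivOn φ (Set.Icc 0 cmax))
    (hp : ∀ z ∈ Set.Icc 0 cmax, HasDerivWithinAt p (p' z) (Set.Icc 0 cmax) z)
    (hp' : ∀ x ∈ Set.Icc 0 cmax, ∀ y ∈ Set.Icc 0 cmax, |p' x - p' y| ≤ a * |x - y|)
    (hF : ∀ x ∈ Set.Icc 0 cmax, F x = φ x + p x) : LipschitzDerivOn F (Set.Icc 0 cmax) := by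
  obtain ⟨φ', h1, C, h2⟩ := hφ
  refine ⟨fun z => φ' z + p' z, fun x hx => ((h1 x hx).add (hp x hx)).congr hF (hF x hx),
    C + a.toNNReal, h2.add ?_⟩
  refine LipschitzOnWith.of_dist_le_mul fun x hx y hy => ?_
  rw [Real.dist_eq, Real.dist_eq]
  exact (hp' x hx y hy).trans
    (mul_le_mul_of_nonneg_right (Real.le_coe_toNNReal a) (abs_nonneg _))

theorem hasDerivWithinAt_affine (c a b x : ℝ) (D : Set ℝ) :
    HasDerivWithinAt (fun x => c * (a - x) + b) (-c) D x := by
  simpa using (((hasDerivWithinAt_id x D).const_sub a).const_mul c).add_const b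

end ResetControl

open ResetControl in
theorem theorem1 {Ω : Type*} {mΩ : MeasurableSpace Ω} (Pr : Measure Ω) [IsProbabilityMeasure Pr]
    (ℱ : Filtration ℕ mΩ) (w : ℕ → Ω → ℝ) (M : ResetControl.Problem)
    (f : ℝ → ℝ) (cmax c K L B : ℝ) (H : ℝ → ℕ → ℝ) (κ m η : ℕ → ℝ)
    (hk : 1 ≤ M.k) (hγ0 : 0 ≤ M.γ) (hγ1 : M.γ < 1)
    (hg : ∀ τ, Measurable fun p : ℝ × ℝ × ℝ => M.g p.1 τ p.2.1 p.2.2)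
    (hs : ∀ t, Measurable fun p : ℝ × ℝ => M.s p.1 t p.2)
    (h1 : ResetControl.A1 M)
    (h2 : ResetControl.A2 M f cmax c K H κ m)
    (h3 : ResetControl.A3 M f cmax η)
    (h4 : ResetControl.A4 M cmax)
    (h5 : ResetControl.A5 Pr w f L B)
    (hinfo : ResetControl.Information Pr ℱ w)
    (hγ : ∀ t < M.k,
      ENNReal.ofReal M.γ ≤ ResetControl.gammaBound M.k cmax c L B κ m η t) :
    -- the optimal cost-to-go is finite, and so are the expectations below
    (∀ t ≤ M.k, ∀ x ∈ Set.Icc 0 cmax, M.value Pr ℱ w x t ≠ ⊤) ∧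
    (∀ t < M.k, ∀ z ∈ Set.Icc 0 cmax,
      Integrable (fun y => M.J Pr ℱ w (max (z - y) 0) (t + 1)) (ResetControl.demandLaw f)) ∧
    -- terminal form
    (∀ x ∈ Set.Icc 0 cmax, M.J Pr ℱ w x M.k = M.J Pr ℱ w 0 0 + M.R f x M.k) ∧
    ∃ φ ∈ Set.Icc (0 : ℝ) cmax, ∃ (σ s : ℕ → EReal) (S : ℕ → ℝ) (Sig : ℕ → EReal),
      (∀ t < M.k, 0 ≤ σ t ∧ σ t ≤ s t ∧ s t ≤ Sig t ∧ S t ∈ Set.Icc 0 cmax) ∧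
      -- the four-threshold policy is optimal
      M.IsOptimalPolicy Pr ℱ w cmax (ResetControl.thresholdPolicy M.k σ s S Sig φ) ∧
      -- the four pieces of the optimal cost-to-go
      (∀ t < M.k, ∀ x ∈ Set.Icc 0 cmax,
        ((x : EReal) < σ t → M.J Pr ℱ w x t = M.J Pr ℱ w 0 0 + M.R f x t) ∧
        (σ t ≤ (x : EReal) → (x : EReal) < s t →
          M.J Pr ℱ w x t = c * (S t - x) + K + H (S t) t +
            M.γ * M.EJ Pr ℱ w f (S t) (t + 1)) ∧
        (s t ≤ (x : EReal) → (x : EReal) < Sig t →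
          M.J Pr ℱ w x t = H x t +
            M.γ * M.EJ Pr ℱ w f x (t + 1)) ∧
        (Sig t ≤ (x : EReal) → M.J Pr ℱ w x t = M.J Pr ℱ w 0 0 + M.R f x t)) ∧
      -- bounded and Lipschitz derivatives of the pieces
      (∀ t < M.k, ∀ Mt, Mt = η t + c + κ t + m t / (L * cmax + B) →
        (ResetControl.BoundedDerivOn (fun x => M.J Pr ℱ w 0 0 + M.R f x t)
            (Set.Icc 0 cmax) Mt ∧
          ResetControl.LipschitzDerivOn (fun x => M.J Pr ℱ w 0 0 + M.R f x t)
            (Set.Icc 0 cmax)) ∧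
        (ResetControl.BoundedDerivOn (fun x => c * (S t - x) + K + H (S t) t +
            M.γ * M.EJ Pr ℱ w f (S t) (t + 1))
            (Set.Icc 0 cmax) Mt ∧
          ResetControl.LipschitzDerivOn (fun x => c * (S t - x) + K + H (S t) t +
            M.γ * M.EJ Pr ℱ w f (S t) (t + 1))
            (Set.Icc 0 cmax)) ∧
        (ResetControl.BoundedDerivOn (fun x => H x t +
            M.γ * M.EJ Pr ℱ w f x (t + 1))
            (Set.Icc 0 cmax) Mt ∧
          (ResetControl.LipschitzDerivOn (fun x => H x t) (Set.Icc 0 cmax) →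
            ResetControl.LipschitzDerivOn (fun x => H x t +
              M.γ * M.EJ Pr ℱ w f x (t + 1))
              (Set.Icc 0 cmax)))) := by

  have h := Setup.of_assumptions hk hγ0 hγ1 h1 h2 h3 h4 h5 hγ
  obtain ⟨lam, V, hV₀, hlam, hle, φ, hφ, heq⟩ := h.exists_fixed_solution
  have hV : IsFixedSolution M f cmax c K H (lipBound M.k cmax c L B κ m η) lam V φ :=
    ⟨hV₀, hlam, hle, hφ, heq⟩
  choose! S σ s Sig hT using hV.threshold
  have hgreedy := isGreedy_thresholdPolicy h hV hT
  have hπ := measurable_thresholdPolicy M.k σ s S Sig φ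
  have hadm : ∀ x ∈ Set.Icc 0 cmax, ∀ t ≤ M.k, M.Admissible Pr ℱ w (x, t)
      (M.feedback w (thresholdPolicy M.k σ s S Sig φ) (x, t)) := fun x hx t ht =>
    admissible_feedback h hinfo h5 hπ (fun x hx t ht => (hgreedy x hx t ht).1) hx ht
  have hcost : ∀ x ∈ Set.Icc 0 cmax, ∀ t ≤ M.k,
      M.cost Pr w (x, t) (M.feedback w (thresholdPolicy M.k σ s S Sig φ) (x, t)) ≤
        ENNReal.ofReal (V t x) := fun x hx t ht =>
    cost_feedback_le h hg hs hinfo h5 hV hπ hgreedy hx ht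
  have hlower : ∀ x ∈ Set.Icc 0 cmax, ∀ t, ENNReal.ofReal (V t x) ≤ M.value Pr ℱ w x t :=
    fun x hx t => le_iInf₂ fun a ha => stateValue_le_cost h hg hs hinfo h5 hV hx ha
  have hvalue : ∀ x ∈ Set.Icc 0 cmax, ∀ t ≤ M.k, M.value Pr ℱ w x t = ENNReal.ofReal (V t x) :=
    fun x hx t ht => le_antisymm ((iInf₂_le _ (hadm x hx t ht)).trans (hcost x hx t ht))
      (hlower x hx t)
  have hJ : ∀ x ∈ Set.Icc 0 cmax, ∀ t ≤ M.k, M.J Pr ℱ w x t = V t x := fun x hx t ht => by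
    rw [Problem.J, hvalue x hx t ht, ENNReal.toReal_ofReal (h.solution_nonneg hV ht x)]
  have hJ0 : M.J Pr ℱ w 0 0 = lam := by
    rw [hJ 0 h.zero_mem 0 (Nat.zero_le _), solution_zero h hV]
  have hEJ : ∀ t < M.k, ∀ z ∈ Set.Icc 0 cmax,
      M.EJ Pr ℱ w f z (t + 1) = expect f (V (t + 1)) z := fun t ht z hz =>
    integral_congr_ae (ae_J_eq hJ h hV ht hz)
  have hprob := h.density.prob
  refine ⟨fun t ht x hx => ?_, fun t ht z hz => ?_, fun x hx => ?_, φ, hφ, σ, s, S, Sig,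
    fun t ht => ⟨(hT t ht).nonneg, (hT t ht).le_s, (hT t ht).le_Sig, (hT t ht).S_mem⟩,
    fun x hx t ht => ⟨hadm x hx t ht, ?_⟩, fun t ht x hx => ?_, ?_⟩
  · rw [hvalue x hx t ht]
    exact ENNReal.ofReal_ne_top
  · exact ((hV.tame (t + 1) ht).integrable h.cmax_nonneg (h.lipBound_nonneg ht) _ z).congr
      (ae_J_eq hJ h hV ht hz).symm
  · rw [hJ x hx _ le_rfl, hJ0, hV.terminal x hx]
  · exact le_antisymm ((hcost x hx t ht).trans (hlower x hx t)) (iInf₂_le _ (hadm x hx t ht))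
  · rw [hJ0, hJ x hx t ht.le, hEJ t ht x hx, hEJ t ht _ (hT t ht).S_mem]
    refine ⟨(hT t ht).low x hx, fun h1 h2 => ?_, (hT t ht).idle x hx, (hT t ht).high x hx⟩
    rw [((hT t ht).order x hx h1 h2).2, contCost]
    ring
  · rintro t ht Mt rfl
    have hη := h.η_nonneg ht.le
    have hκ := h.κ_nonneg ht
    have hm := h.slope_nonneg ht
    have hc := h.stage.c_nonneg
    have hVt := hV.tame (t + 1) ht
    have hp : ∀ z ∈ Set.Icc 0 cmax, HasDerivWithinAt (fun z => M.γ * expect f (V (t + 1)) z)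
        (M.γ * expectDeriv f (V (t + 1)) z) (Set.Icc 0 cmax) z := fun z _ =>
      ((hasDerivAt_expect h.density hVt h.cmax_nonneg
        (h.lipBound_nonneg ht) z).const_mul M.γ).hasDerivWithinAt
    have hF : ∀ x ∈ Set.Icc 0 cmax, H x t + M.γ * M.EJ Pr ℱ w f x (t + 1) =
        H x t + M.γ * expect f (V (t + 1)) x := fun x hx => by rw [hEJ t ht x hx]
    -- Regrouped, the ordering piece is affine in x with slope -c.
    have hS : (fun x => c * (S t - x) + K + H (S t) t + M.γ * M.EJ Pr ℱ w f (S t) (t + 1)) =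
        fun x => c * (S t - x) + (K + H (S t) t + M.γ * M.EJ Pr ℱ w f (S t) (t + 1)) := by
      ext x
      ring
    refine ⟨⟨?_, ?_⟩, ⟨?_, ?_⟩, ?_, fun hH => ?_⟩
    · obtain ⟨ψ, hψ⟩ := h.reset.deriv_bdd t ht.le
      exact ⟨ψ, fun x hx => ⟨(hψ x hx).1.const_add _, (hψ x hx).2.trans (by linarith)⟩⟩
    · obtain ⟨ψ, hψ, C, hC⟩ := h.reset.deriv_lip t ht.le
      exact ⟨ψ, fun x hx => (hψ x hx).const_add _, C, hC⟩
    · rw [hS]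
      refine ⟨fun _ => -c, fun x _ => ⟨hasDerivWithinAt_affine _ _ _ _ _, ?_⟩⟩
      rw [abs_neg, abs_of_nonneg hc]
      linarith
    · rw [hS]
      exact ⟨fun _ => -c, fun x _ => hasDerivWithinAt_affine _ _ _ _ _, 0,
        LipschitzWith.lipschitzOnWith (LipschitzWith.const _)⟩
    · obtain ⟨H', H'', hH⟩ := h.stage.deriv_H t ht
      refine ⟨fun z => H' z + M.γ * expectDeriv f (V (t + 1)) z, fun x hx =>
        ⟨((hH x hx).1.add (hp x hx)).congr hF (hF x hx), (abs_add_le _ _).trans ?_⟩⟩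
      linarith [(hH x hx).2.2.1, h.abs_γ_mul_expectDeriv_le ht hVt x]
    · exact hH.of_eq_add hp (fun x hx y hy => h.γ_mul_expectDeriv_lipschitz ht hVt hx hy) hF
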